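/- For $n\ge 1$ let $F_n(x)=\sum_{k=1}^n p_k(n)x^k$, where $p_k(n)$ is the number of partitions of $n$ with exactly $k$ parts. Let $\mathrm{Li}_2(x)=\sum_{m\ge1}x^m/m^2$ for $|x|\le 1$, let $\sqrt{\cdot}$ be the principal square root and $\ln$ the principal logarithm, and put $f_k(x)=\frac1k\,\mathrm{Re}\sqrt{\mathrm{Li}_2(x^k)}$. Let $U^+=\{x\in\mathbb C: |x|<1,\ \mathrm{Im}\,x>0\}$, and for $k\in\{1,2,3\}$ let $$\mathcal R(k)=\{x\in U^+ : f_k(x)>f_j(x)\ \text{for all}\ j\in\{1,2,3\},\ j\ne k\}.$$ For integers $0\le h<k$ with $\gcd(h,k)=1$ define $$w_{h,k}(x)=\frac1{2k}\ln(1-x^k)+\sum_{l\ge1,\ k\nmid l}\frac{x^l}{l}\,\frac1{e^{-2\pi i l h/k}-1},$$ $$I_k=I_k(n,x)=\frac1{2\sqrt\pi}\,\frac1{n^{3/4}}\left[\frac{\sqrt{\mathrm{Li}_2(x^k)}}{k}\right]^{1/2}\exp\!\left(2\sqrt n\,\frac{\sqrt{\mathrm{Li}_2(x^k)}}{k}\right),$$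 where $[\cdot]^{1/2}$ is again the principal square root. Then, as $n\to\infty$: (a) $F_n(x)=e^{w_{0,1}(x)}I_1+o(I_1)$, uniformly on every compact subset of $\mathcal R(1)$; (b) $F_n(x)=(-1)^n e^{w_{1,2}(x)}I_2+o(I_2)$, uniformly on every compact subset of $\mathcal R(2)$; (c) $F_n(x)=\left(e^{-2\pi i n/3}e^{w_{1,3}(x)}+e^{-4\pi i n/3}e^{w_{2,3}(x)}\right)I_3+o(I_3)$, uniformly on every compact subset of $\mathcal R(3)$. -/

import Mathlib

noncomputable section

namespace PartitionPolynomials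

/-- `p_k(n)`: the number of partitions of `n` with exactly `k` parts. -/
def numPartitions (k n : ℕ) : ℕ :=
  (Finset.univ.filter fun p : n.Partition => p.parts.card = k).card

/-- The partition polynomial `F_n(x) = ∑_{k=1}^n p_k(n) x^k`. -/
def F (n : ℕ) : Polynomial ℂ :=
  ∑ k ∈ Finset.Icc 1 n, Polynomial.C (numPartitions k n : ℂ) * Polynomial.X ^ k

/-- The dilogarithm `Li₂(x) = ∑_{m ≥ 1} x^m / m^2` (convergent for `‖x‖ ≤ 1`). -/
def Li2 (x : ℂ) : ℂ := ∑' m : ℕ, x ^ (m + 1) / ((m : ℂ) + 1) ^ 2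

/-- The principal square root on `ℂ`. -/
def csqrt (z : ℂ) : ℂ := z ^ (1 / 2 : ℂ)

/-- `L_k(x) = √(Li₂(x^k)) / k`. -/
def L (k : ℕ) (x : ℂ) : ℂ := csqrt (Li2 (x ^ k)) / k

/-- `f_k(x) = Re √(Li₂(x^k)) / k`. -/
def f (k : ℕ) (x : ℂ) : ℝ := (L k x).re

/-- The open upper half of the unit disk. -/
def upperHalfDisk : Set ℂ := {x | ‖x‖ < 1 ∧ 0 < x.im}

/-- The part of the upper half-disk on which `f_k` is strictly the largest
of `f_1, f_2, f_3` (for `k = 1, 2, 3`). -/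
def region (k : ℕ) : Set ℂ :=
  {x | x ∈ upperHalfDisk ∧ ∀ j ∈ Finset.Icc 1 3, j ≠ k → f j x < f k x}

/-- `w_{h,k}(x) = ln(1 - x^k) / (2k) + ∑_{l ≥ 1, k ∤ l} (x^l / l) / (e^{-2πi l h/k} - 1)`.
The index `l = 0` does not contribute, because `k ∣ 0`. -/
def w (h k : ℕ) (x : ℂ) : ℂ :=
  Complex.log (1 - x ^ k) / (2 * k) +
    ∑' l : ℕ, if k ∣ l then 0 else
      x ^ l / l * (1 / (Complex.exp (-2 * Real.pi * Complex.I * l * h / k) - 1))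

/-- `I_k = (1 / (2 √π)) n^{-3/4} [√(Li₂(x^k)) / k]^{1/2} exp(2 √n √(Li₂(x^k)) / k)`. -/
def mainTerm (k n : ℕ) (x : ℂ) : ℂ :=
  1 / (2 * (Real.sqrt Real.pi : ℂ)) * (((n : ℝ) ^ (-(3 / 4) : ℝ) : ℝ) : ℂ) *
    csqrt (L k x) * Complex.exp (2 * (Real.sqrt n : ℂ) * L k x)

/-- `A_n(x) = B_n(x) + o(E_n(x))` as `n → ∞`, uniformly for `x` in every compact subset of `S`. -/
def AsympOnCompacts (S : Set ℂ) (A B E : ℕ → ℂ → ℂ) : Prop :=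
  ∀ K : Set ℂ, IsCompact K → K ⊆ S → ∀ ε : ℝ, 0 < ε →
    ∃ N : ℕ, ∀ n ≥ N, ∀ x ∈ K, ‖A n x - B n x‖ ≤ ε * ‖E n x‖

end PartitionPolynomials

end

/-!
The circle method. The generating function is `∑ₙ Fₙ(x) qⁿ = ∏ₘ (1 - x qᵐ)⁻¹`. As `q` approaches a
primitive `k`-th root of unity, `q = e^(-τ) e^(2πih/k)` with `τ → 0`, its logarithm is
`L_k(x)² / τ + w_{h,k}(x) + o(1)`, where `L_k(x) = √(Li₂(x^k)) / k` has real part `f_k(x)`. Cauchy's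
formula for `Fₙ(x)` therefore has a saddle point at `τ = L_k(x) / √n`, which contributes
`exp(2 √n L_k(x))` times a Gaussian factor. Where `f_k > f_j` for all `j ≠ k`, the saddle points at
the primitive `k`-th roots of unity dominate everything else on the circle of radius
`exp(-f_k(x) / √n)`. For `Im x > 0` no `f_j` with `j ≥ 4` reaches both `f₁` and `f₂`, which is why
only `k ≤ 3` is compared in the definition of the regions. All limits are joint limits `n → ∞`,
`y → x`, which compactness turns into uniformity.
-/

noncomputable section

namespace PartitionPolynomials

open Complex Filter Topology
open scoped Real

/-! ### The principal square root -/

lemma sq_csqrt (z : ℂ) : csqrt z ^ 2 = z := by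
  rw [csqrt, one_div, cpow_ofNat_inv_pow]

lemma re_csqrt (z : ℂ) : (csqrt z).re = √((‖z‖ + z.re) / 2) := by
  rw [csqrt, one_div, cpow_inv_two_re]

lemma re_csqrt_nonneg (z : ℂ) : 0 ≤ (csqrt z).re := by
  rw [re_csqrt]
  exact Real.sqrt_nonneg _

lemma sq_re_csqrt (z : ℂ) : (csqrt z).re ^ 2 = (‖z‖ + z.re) / 2 := by
  rw [re_csqrt, Real.sq_sqrt]
  linarith [neg_le_of_abs_le (abs_re_le_norm z)]

/-- The half-plane on the left is tangent to the parabola `(Re √z)² = B`. -/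
lemma lt_sq_re_csqrt {z : ℂ} {B : ℝ} (lam : ℝ) (h : B * (1 + lam ^ 2) < z.re + lam * z.im) :
    B < (csqrt z).re ^ 2 := by
  rw [← sq_csqrt z, pow_two (csqrt z), mul_re, mul_im] at h
  have : 0 < 1 + lam ^ 2 := by positivity
  nlinarith [sq_nonneg ((csqrt z).im - lam * (csqrt z).re)]

lemma f_nonneg (k : ℕ) (x : ℂ) : 0 ≤ f k x := by
  rw [f, L, div_natCast_re]
  exact div_nonneg (re_csqrt_nonneg _) k.cast_nonneg

lemma f_sq (k : ℕ) (x : ℂ) : f k x ^ 2 = (csqrt (Li2 (x ^ k))).re ^ 2 / k ^ 2 := by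
  rw [f, L, div_natCast_re, div_pow]

/-! ### The dilogarithm -/

lemma hasSum_one_div_succ_sq : HasSum (fun m : ℕ => 1 / ((m : ℝ) + 1) ^ 2) (π ^ 2 / 6) := by
  simpa using (hasSum_nat_add_iff' 1).2 hasSum_zeta_two

lemma norm_natCast_succ (m : ℕ) : ‖(m : ℂ) + 1‖ = (m : ℝ) + 1 := by
  exact_mod_cast norm_natCast (m + 1)

lemma norm_Li2_term (x : ℂ) (m : ℕ) :
    ‖x ^ (m + 1) / ((m : ℂ) + 1) ^ 2‖ = ‖x‖ ^ (m + 1) * (1 / ((m : ℝ) + 1) ^ 2) := by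
  rw [norm_div, norm_pow, norm_pow, norm_natCast_succ, mul_one_div]

lemma summable_norm_Li2_term {x : ℂ} (hx : ‖x‖ ≤ 1) :
    Summable fun m : ℕ => ‖x ^ (m + 1) / ((m : ℂ) + 1) ^ 2‖ := by
  refine hasSum_one_div_succ_sq.summable.of_nonneg_of_le (fun _ => norm_nonneg _) fun m => ?_
  rw [norm_Li2_term]
  exact mul_le_of_le_one_left (by positivity) (pow_le_one₀ (norm_nonneg _) hx)

lemma norm_Li2_le {x : ℂ} (hx : ‖x‖ ≤ 1) : ‖Li2 x‖ ≤ ‖x‖ * (π ^ 2 / 6) := by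
  refine tsum_of_norm_bounded (hasSum_one_div_succ_sq.mul_left ‖x‖) fun m => ?_
  rw [norm_Li2_term]
  gcongr
  exact pow_le_of_le_one (norm_nonneg _) hx (Nat.succ_ne_zero m)

lemma Li2_zero : Li2 0 = 0 := by simp [Li2]

lemma Li2_conj (x : ℂ) : Li2 (starRingEnd ℂ x) = starRingEnd ℂ (Li2 x) := by
  simp [Li2, conj_tsum]

lemma hasDerivAt_Li2 {x : ℂ} (hx : ‖x‖ < 1) :
    HasDerivAt Li2 (∑' m : ℕ, x ^ m / ((m : ℂ) + 1)) x := by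
  obtain ⟨ρ, hxρ, hρ⟩ := exists_between hx
  have hasDerivAt_term (m : ℕ) (y : ℂ) : HasDerivAt
      (fun z : ℂ => z ^ (m + 1) / ((m : ℂ) + 1) ^ 2) (y ^ m / ((m : ℂ) + 1)) y := by
    have : (m : ℂ) + 1 ≠ 0 := Nat.cast_add_one_ne_zero m
    refine ((hasDerivAt_pow (m + 1) y).div_const (((m : ℂ) + 1) ^ 2)).congr_deriv ?_
    push_cast
    field_simp
  have norm_deriv_le (m : ℕ) (y : ℂ) (hy : y ∈ Metric.ball (0 : ℂ) ρ) :
      ‖y ^ m / ((m : ℂ) + 1)‖ ≤ ρ ^ m := by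
    rw [norm_div, norm_pow, norm_natCast_succ]
    refine (div_le_self (by positivity) (by simp)).trans ?_
    gcongr
    exact (mem_ball_zero_iff.1 hy).le
  have hmem : x ∈ Metric.ball (0 : ℂ) ρ := mem_ball_zero_iff.2 hxρ
  exact hasDerivAt_tsum_of_isPreconnected
    (summable_geometric_of_lt_one ((norm_nonneg x).trans hxρ.le) hρ) Metric.isOpen_ball
    (convex_ball (0 : ℂ) ρ).isPreconnected (fun m y _ => hasDerivAt_term m y) norm_deriv_le
    hmem (summable_norm_Li2_term hx.le).of_norm hmem

lemma mul_tsum_pow_div_succ {x : ℂ} (hx : ‖x‖ < 1) :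
    x * ∑' m : ℕ, x ^ m / ((m : ℂ) + 1) = -log (1 - x) := by
  rw [← (hasSum_taylorSeries_neg_log' hx).tsum_eq, ← tsum_mul_left]
  congr 1 with m
  rw [pow_succ', mul_div_assoc]

lemma norm_ofReal_mul_lt_one {x : ℂ} (hx : ‖x‖ < 1) {t : ℝ} (ht : t ∈ Set.Icc (0 : ℝ) 1) :
    ‖(t : ℂ) * x‖ < 1 := by
  rw [norm_mul, norm_real, Real.norm_of_nonneg ht.1]
  exact (mul_le_of_le_one_left (norm_nonneg x) ht.2).trans_lt hx

lemma hasDerivAt_re_mul_Li2_ofReal_mul {x : ℂ} (c : ℂ) {t : ℝ} (ht : ‖(t : ℂ) * x‖ < 1) :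
    HasDerivAt (fun s : ℝ => (c * Li2 (s * x)).re)
      (c * ((∑' m : ℕ, (t * x) ^ m / ((m : ℂ) + 1)) * x)).re t := by
  have hmul : HasDerivAt (fun s : ℂ => s * x) x (t : ℂ) := by
    simpa using (hasDerivAt_id (t : ℂ)).mul_const x
  exact ((((hasDerivAt_Li2 ht).comp (t : ℂ) hmul).const_mul c).real_of_complex)

/-- The integrand of `Li₂ x = -∫₀¹ log (1 - t x) dt / t` is bounded below by an affine function
of `t`. -/
lemma le_re_mul_Li2 {x : ℂ} (hx : ‖x‖ < 1) (c : ℂ) (a b : ℝ)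
    (h : ∀ t ∈ Set.Ioo (0 : ℝ) 1, t * (a + b * t) ≤ (c * -log (1 - t * x)).re) :
    a + b / 2 ≤ (c * Li2 x).re := by
  let g (s : ℝ) : ℝ := (c * Li2 (s * x)).re - (a * s + b * s ^ 2 / 2)
  let g' (t : ℝ) : ℝ := (c * ((∑' m : ℕ, (t * x) ^ m / ((m : ℂ) + 1)) * x)).re - (a + b * t)
  have hasDerivAt_g (t) (ht : t ∈ Set.Icc (0 : ℝ) 1) : HasDerivAt g (g' t) t := by
    have hquad := ((hasDerivAt_id t).const_mul a).add
      (((hasDerivAt_pow 2 t).const_mul b).div_const 2)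
    refine ((hasDerivAt_re_mul_Li2_ofReal_mul c (norm_ofReal_mul_lt_one hx ht)).sub
      hquad).congr_deriv ?_
    simp only [g']
    norm_num
    ring
  have g'_nonneg (t) (ht : t ∈ Set.Ioo (0 : ℝ) 1) : 0 ≤ g' t := by
    have hlog := h t ht
    rw [← mul_tsum_pow_div_succ (norm_ofReal_mul_lt_one hx (Set.Ioo_subset_Icc_self ht)),
      mul_assoc, mul_left_comm, re_ofReal_mul, mul_comm x] at hlog
    exact sub_nonneg.2 (le_of_mul_le_mul_left hlog ht.1)
  have hmono : MonotoneOn g (Set.Icc 0 1) :=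
    monotoneOn_of_hasDerivWithinAt_nonneg (convex_Icc 0 1)
      (fun t ht => (hasDerivAt_g t ht).continuousAt.continuousWithinAt)
      (fun t ht => (hasDerivAt_g t (interior_subset ht)).hasDerivWithinAt)
      (fun t ht => g'_nonneg t (interior_Icc (a := (0 : ℝ)) ▸ ht))
  have := hmono (Set.left_mem_Icc.2 zero_le_one) (Set.right_mem_Icc.2 zero_le_one) zero_le_one
  simp only [g, ofReal_zero, zero_mul, Li2_zero, mul_zero, zero_re, ofReal_one, one_mul, mul_one,
    one_pow] at this
  linarith

lemma one_sub_ne_zero {z : ℂ} (hz : ‖z‖ < 1) : 1 - z ≠ 0 :=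
  sub_ne_zero.2 fun h => by simp [← h] at hz

lemma norm_one_sub_sq (z : ℂ) : ‖1 - z‖ ^ 2 = 1 - 2 * z.re + ‖z‖ ^ 2 := by
  rw [norm_sub_sq_real]
  simp

lemma re_log_one_sub (z : ℂ) : (log (1 - z)).re = Real.log (1 - 2 * z.re + ‖z‖ ^ 2) / 2 := by
  rw [log_re, ← norm_one_sub_sq, Real.log_pow]
  push_cast
  ring

lemma one_sub_two_mul_re_add_pos {z : ℂ} (hz : ‖z‖ < 1) : 0 < 1 - 2 * z.re + ‖z‖ ^ 2 := by
  rw [← norm_one_sub_sq]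
  have := norm_pos_iff.2 (one_sub_ne_zero hz)
  positivity

lemma re_sub_le_re_Li2 {x : ℂ} (hx : ‖x‖ < 1) : x.re - ‖x‖ ^ 2 / 4 ≤ (Li2 x).re := by
  suffices x.re + -(‖x‖ ^ 2) / 2 / 2 ≤ (1 * Li2 x).re by rw [one_mul] at this; linarith
  refine le_re_mul_Li2 hx 1 _ _ fun t ht => ?_
  have hlog := Real.log_le_sub_one_of_pos
    (one_sub_two_mul_re_add_pos (norm_ofReal_mul_lt_one hx (Set.Ioo_subset_Icc_self ht)))
  rw [one_mul, neg_re, re_log_one_sub]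
  rw [re_ofReal_mul, norm_mul, norm_real, Real.norm_of_nonneg ht.1.le] at *
  linarith

lemma neg_mul_norm_le_re_Li2 {x : ℂ} (hx : ‖x‖ < 1) {κ : ℝ} (hκ : 0 ≤ κ) (hκ2 : 1 ≤ 2 * κ ^ 2)
    (h : -(κ * ‖x‖) ≤ x.re) : -(κ * ‖x‖) ≤ (Li2 x).re := by
  suffices -(κ * ‖x‖) + 0 / 2 ≤ (1 * Li2 x).re by rw [one_mul] at this; linarith
  refine le_re_mul_Li2 hx 1 _ _ fun t ht => ?_
  have hlog : Real.log (1 - 2 * ((t : ℂ) * x).re + ‖(t : ℂ) * x‖ ^ 2) ≤ 2 * κ * (t * ‖x‖) := by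
    have hκt : 0 ≤ 2 * κ * (t * ‖x‖) := by have := ht.1; positivity
    rw [Real.log_le_iff_le_exp
      (one_sub_two_mul_re_add_pos (norm_ofReal_mul_lt_one hx (Set.Ioo_subset_Icc_self ht)))]
    refine le_trans ?_ (Real.quadratic_le_exp_of_nonneg hκt)
    rw [re_ofReal_mul, norm_mul, norm_real, Real.norm_of_nonneg ht.1.le]
    nlinarith [mul_le_mul_of_nonneg_left h ht.1.le,
      mul_le_mul_of_nonneg_left hκ2 (sq_nonneg (t * ‖x‖))]
  rw [one_mul, neg_re, re_log_one_sub]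
  linarith

lemma re_Li2_nonpos {x : ℂ} (hx : ‖x‖ < 1) (h : x.re ≤ 0) : (Li2 x).re ≤ 0 := by
  suffices 0 + 0 / 2 ≤ (-1 * Li2 x).re by rw [neg_one_mul, neg_re] at this; linarith
  refine le_re_mul_Li2 hx (-1) _ _ fun t ht => ?_
  have hlog : 0 ≤ Real.log (1 - 2 * ((t : ℂ) * x).re + ‖(t : ℂ) * x‖ ^ 2) := by
    refine Real.log_nonneg ?_
    rw [re_ofReal_mul]
    nlinarith [mul_nonneg ht.1.le (neg_nonneg.2 h), sq_nonneg ‖(t : ℂ) * x‖]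
  rw [neg_one_mul, neg_neg, re_log_one_sub]
  linarith

lemma neg_im_div_norm_le_neg_arg {z : ℂ} (hre : 0 ≤ z.re) (him : z.im ≤ 0) :
    -z.im / ‖z‖ ≤ -arg z := by
  have harg : arg z ≤ 0 := by
    rcases him.eq_or_lt with h0 | h0
    · exact (arg_eq_zero_iff.2 ⟨hre, h0⟩).le
    · exact (arg_neg_iff.2 h0).le
  rw [neg_div, ← sin_arg, ← Real.sin_neg]
  exact Real.sin_le (neg_nonneg.2 harg)

lemma norm_one_sub_ofReal_mul_le (x : ℂ) {t : ℝ} (ht : t ∈ Set.Icc (0 : ℝ) 1) :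
    ‖1 - (t : ℂ) * x‖ ≤ 1 - t + t * ‖1 - x‖ := by
  have : 1 - (t : ℂ) * x = ((1 - t : ℝ) : ℂ) + (t : ℂ) * (1 - x) := by push_cast; ring
  rw [this]
  refine (norm_add_le _ _).trans_eq ?_
  rw [norm_mul, norm_real, norm_real, Real.norm_of_nonneg ht.1,
    Real.norm_of_nonneg (sub_nonneg.2 ht.2)]

lemma two_div_sub_div_sq_le_one_div {q s : ℝ} (hq : 0 < q) (hs : 0 < s) :
    2 / q - s / q ^ 2 ≤ 1 / s := by
  have : 1 / s - (2 / q - s / q ^ 2) = (q - s) ^ 2 / (s * q ^ 2) := by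
    field_simp
    ring
  rw [← sub_nonneg, this]
  positivity

/-- The integrand of `Im Li₂ x` is at least `Im x / |1 - t x|`; then `|1 - t x|` is bounded by
convexity in `t`, and its reciprocal by the tangent at the midpoint `t = 1 / 2`. -/
lemma le_im_Li2 {x : ℂ} (hx : ‖x‖ < 1) (h : 0 ≤ x.im) :
    2 * x.im / (1 + ‖1 - x‖) ≤ (Li2 x).im := by
  set D := ‖1 - x‖
  have hq : 0 < (1 + D) / 2 := by positivity
  set q := (1 + D) / 2
  suffices x.im * (2 / q - 1 / q ^ 2) + -(x.im * ((D - 1) / q ^ 2)) / 2 ≤ (-I * Li2 x).re by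
    refine le_trans (le_of_eq ?_) (this.trans_eq (by simp))
    rw [show 1 + D = 2 * q by ring, show D = 2 * q - 1 by ring]
    field_simp
    ring
  refine le_re_mul_Li2 hx _ _ _ fun t ht => ?_
  have htI := Set.Ioo_subset_Icc_self ht
  have htx := norm_ofReal_mul_lt_one hx htI
  have hnorm := norm_pos_iff.2 (one_sub_ne_zero htx)
  calc t * (x.im * (2 / q - 1 / q ^ 2) + -(x.im * ((D - 1) / q ^ 2)) * t)
      = t * x.im * (2 / q - (1 - t + t * D) / q ^ 2) := by ring
    _ ≤ t * x.im * (1 / (1 - t + t * D)) := by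
      have := two_div_sub_div_sq_le_one_div hq
        (hnorm.trans_le (norm_one_sub_ofReal_mul_le x htI))
      have := ht.1.le
      gcongr
    _ ≤ t * x.im * (1 / ‖1 - (t : ℂ) * x‖) := by
      have := norm_one_sub_ofReal_mul_le x htI
      have := ht.1.le
      gcongr
    _ = -(1 - (t : ℂ) * x).im / ‖1 - (t : ℂ) * x‖ := by simp [div_eq_mul_inv]
    _ ≤ -arg (1 - t * x) := by
      refine neg_im_div_norm_le_neg_arg ?_ ?_
      · rw [sub_re, one_re]
        linarith [re_le_norm ((t : ℂ) * x)]
      · have := mul_nonneg ht.1.le h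
        simpa
    _ = (-I * -log (1 - t * x)).re := by simp [log_im]

/-! ### Only `f₁`, `f₂` and `f₃` compete -/

lemma f_sq_le {x : ℂ} (hx : ‖x‖ < 1) {j k : ℕ} (hk : 1 ≤ k) (hj : k ≤ j) :
    f j x ^ 2 ≤ ‖x‖ ^ k * (π ^ 2 / 6 / k ^ 2) := by
  have hpow : ‖x ^ j‖ ≤ ‖x‖ ^ k := by
    rw [norm_pow]
    exact pow_le_pow_of_le_one (norm_nonneg _) hx.le hj
  have hLi : ‖Li2 (x ^ j)‖ ≤ ‖x‖ ^ k * (π ^ 2 / 6) :=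
    (norm_Li2_le (hpow.trans (pow_le_one₀ (norm_nonneg _) hx.le))).trans (by gcongr)
  have : (0 : ℝ) < k := by exact_mod_cast hk
  rw [f_sq, sq_re_csqrt, ← mul_div_assoc]
  gcongr
  linarith [re_le_norm (Li2 (x ^ j))]

lemma f_four_sq_le {x : ℂ} (hx : ‖x‖ < 1) (h : (x ^ 4).re ≤ 0) :
    f 4 x ^ 2 ≤ ‖x‖ ^ 4 * (π ^ 2 / 192) := by
  have hx4 : ‖x ^ 4‖ < 1 := by
    rw [norm_pow]
    exact pow_lt_one₀ (norm_nonneg _) hx (by norm_num)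
  have hLi := norm_Li2_le hx4.le
  have hre := re_Li2_nonpos hx4 h
  rw [norm_pow] at hLi
  rw [f_sq, sq_re_csqrt]
  push_cast
  linarith

lemma pi_sq_lt : π ^ 2 < 9.87 := by
  nlinarith [Real.pi_lt_d4, Real.pi_pos]

lemma f_sq_le_of_four_le {x : ℂ} (hx : ‖x‖ < 1) {j : ℕ} (hj : 4 ≤ j) :
    f j x ^ 2 ≤ ‖x‖ ^ 4 * (9.87 / 96) := by
  refine (f_sq_le hx (by norm_num) hj).trans (mul_le_mul_of_nonneg_left ?_ (by positivity))
  push_cast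
  linarith [pi_sq_lt]

lemma f_sq_le_of_four_le_of_re_pow_nonpos {x : ℂ} (hx : ‖x‖ < 1) (h : (x ^ 4).re ≤ 0) {j : ℕ}
    (hj : 4 ≤ j) : f j x ^ 2 ≤ ‖x‖ ^ 4 * (9.87 / 150) := by
  have hpi := pi_sq_lt
  rcases hj.eq_or_lt with rfl | hj'
  · refine (f_four_sq_le hx h).trans ?_
    gcongr
    linarith
  · refine (f_sq_le hx (by norm_num) hj').trans (mul_le_mul ?_ ?_ (by positivity) (by positivity))
    · exact pow_le_pow_of_le_one (norm_nonneg x) hx.le (Nat.le_succ 4)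
    · push_cast
      linarith

lemma f_lt_f_of_le_of_lt {x : ℂ} {j k : ℕ} (hk : 0 < k) {B : ℝ} (lam : ℝ) (hB : f j x ^ 2 ≤ B)
    (h : k ^ 2 * B * (1 + lam ^ 2) < (Li2 (x ^ k)).re + lam * (Li2 (x ^ k)).im) :
    f j x < f k x := by
  have hk' : (0 : ℝ) < k ^ 2 := by positivity
  refine lt_of_pow_lt_pow_left₀ 2 (f_nonneg k x) (hB.trans_lt ?_)
  rw [f_sq, lt_div_iff₀' hk']
  exact lt_sq_re_csqrt lam h

lemma mul_im_le_im_Li2 {x : ℂ} (hx : ‖x‖ < 1) (him : 0 ≤ x.im) {c D : ℝ} (hD : 0 ≤ D)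
    (h : 1 - 2 * x.re + ‖x‖ ^ 2 ≤ D ^ 2) (hc : c * (1 + D) ≤ 2) :
    c * x.im ≤ (Li2 x).im := by
  have hnorm : ‖1 - x‖ ≤ D := le_of_sq_le_sq (norm_one_sub_sq x ▸ h) hD
  calc c * x.im ≤ 2 / (1 + D) * x.im := by
        gcongr
        rwa [le_div_iff₀ (by positivity)]
    _ = 2 * x.im / (1 + D) := div_mul_eq_mul_div _ _ _
    _ ≤ 2 * x.im / (1 + ‖1 - x‖) := by gcongr
    _ ≤ (Li2 x).im := le_im_Li2 hx him

lemma im_Li2_le_mul_im {x : ℂ} (hx : ‖x‖ < 1) (him : x.im ≤ 0) {c D : ℝ} (hD : 0 ≤ D)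
    (h : 1 - 2 * x.re + ‖x‖ ^ 2 ≤ D ^ 2) (hc : c * (1 + D) ≤ 2) :
    (Li2 x).im ≤ c * x.im := by
  have := mul_im_le_im_Li2 (x := starRingEnd ℂ x) (by rwa [norm_conj]) (by simpa using him) hD
    (by rwa [norm_conj, conj_re]) hc
  rw [Li2_conj, conj_im, conj_im] at this
  linarith

lemma norm_sq_eq_re_sq_add_im_sq (x : ℂ) : ‖x‖ ^ 2 = x.re ^ 2 + x.im ^ 2 := by
  linarith [sq_norm_sub_sq_re x]

lemma re_sq (x : ℂ) : (x ^ 2).re = x.re ^ 2 - x.im ^ 2 := by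
  rw [pow_two, mul_re]
  ring

lemma re_pow_four (x : ℂ) : (x ^ 4).re = ‖x‖ ^ 4 - 8 * x.re ^ 2 * x.im ^ 2 := by
  rw [show ‖x‖ ^ 4 = (‖x‖ ^ 2) ^ 2 by ring, norm_sq_eq_re_sq_add_im_sq,
    show x ^ 4 = (x * x) * (x * x) by ring]
  simp only [mul_re, mul_im]
  ring

section Sectors

variable {x : ℂ} (hx : ‖x‖ < 1) {j : ℕ} (hj : 4 ≤ j)

include hx hj

lemma f_lt_f_one_of_re_nonneg (him : 0 < x.im) (hre : 0 ≤ x.re) : f j x < f 1 x := by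
  have hr : 0 < ‖x‖ := norm_pos_iff.2 (by rintro rfl; simp at him)
  have hr2 := pow_le_of_le_one hr.le hx.le two_ne_zero
  have hr4 := pow_le_of_le_one hr.le hx.le four_ne_zero
  have hLi_re := re_sub_le_re_Li2 hx
  have hLi_im := mul_im_le_im_Li2 hx him.le (c := 0.828) (D := 1.4143) (by norm_num)
    (by linarith) (by norm_num)
  have hnorm := norm_le_abs_re_add_abs_im x
  rw [abs_of_nonneg hre, abs_of_pos him] at hnorm
  refine f_lt_f_of_le_of_lt one_pos 1 (f_sq_le_of_four_le hx hj) ?_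
  rw [pow_one]
  push_cast
  linarith

lemma f_lt_f_one_of_re_pow_four_nonpos (him : 0 < x.im) (hre : x.re < 0)
    (h2 : (x ^ 2).re ≤ 0) (h4 : (x ^ 4).re ≤ 0) : f j x < f 1 x := by
  have hr : 0 < ‖x‖ := norm_pos_iff.2 (by rintro rfl; simp at him)
  have hr2 := pow_le_of_le_one hr.le hx.le two_ne_zero
  have hr4 := pow_le_of_le_one hr.le hx.le four_ne_zero
  have hnorm := norm_sq_eq_re_sq_add_im_sq x
  rw [re_sq] at h2
  have hre_le : -x.re ≤ 0.7072 * ‖x‖ :=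
    le_of_sq_le_sq (by rw [mul_pow]; linarith [sq_nonneg ‖x‖]) (by linarith)
  have hle_im : 0.707 * ‖x‖ ≤ x.im :=
    le_of_sq_le_sq (by rw [mul_pow]; linarith [sq_nonneg ‖x‖]) him.le
  have hLi_re := neg_mul_norm_le_re_Li2 hx (κ := 0.7072) (by norm_num) (by norm_num)
    (by linarith)
  have hLi_im := mul_im_le_im_Li2 hx him.le (c := 0.702) (D := 1.848) (by norm_num)
    (by linarith) (by norm_num)
  refine f_lt_f_of_le_of_lt one_pos 4 (f_sq_le_of_four_le_of_re_pow_nonpos hx h4 hj) ?_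
  rw [pow_one]
  push_cast
  linarith

lemma f_lt_f_one_of_re_pow_four_pos (him : 0 < x.im) (hre : x.re < 0)
    (h2 : (x ^ 2).re ≤ 0) (h4 : 0 < (x ^ 4).re) : f j x < f 1 x := by
  have hr : 0 < ‖x‖ := norm_pos_iff.2 (by rintro rfl; simp at him)
  have hr2 := pow_le_of_le_one hr.le hx.le two_ne_zero
  have hr4 := pow_le_of_le_one hr.le hx.le four_ne_zero
  have hr42 := pow_le_pow_of_le_one hr.le hx.le (show 2 ≤ 4 by norm_num)
  have hnorm := norm_sq_eq_re_sq_add_im_sq x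
  rw [re_sq] at h2
  have hre_sq : x.re ^ 2 ≤ 0.1465 * ‖x‖ ^ 2 := by
    have hhalf : x.re ^ 2 ≤ ‖x‖ ^ 2 / 2 := by linarith
    rw [re_pow_four, show x.im ^ 2 = ‖x‖ ^ 2 - x.re ^ 2 by linarith,
      show ‖x‖ ^ 4 = ‖x‖ ^ 2 * ‖x‖ ^ 2 by ring] at h4
    by_contra! hlt
    nlinarith [mul_nonneg (sub_nonneg.2 hhalf) (sub_nonneg.2 hlt.le)]
  have hre_le : -x.re ≤ 0.3828 * ‖x‖ :=
    le_of_sq_le_sq (by rw [mul_pow]; linarith [sq_nonneg ‖x‖]) (by linarith)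
  have hle_im : 0.923 * ‖x‖ ≤ x.im :=
    le_of_sq_le_sq (by rw [mul_pow]; linarith [sq_nonneg ‖x‖]) him.le
  have hLi_re := re_sub_le_re_Li2 hx
  have hLi_im := mul_im_le_im_Li2 hx him.le (c := 0.75) (D := 1.664) (by norm_num)
    (by linarith) (by norm_num)
  refine f_lt_f_of_le_of_lt one_pos 2 (f_sq_le_of_four_le hx hj) ?_
  rw [pow_one]
  push_cast
  linarith

lemma f_lt_f_two_of_re_pow_four_nonpos (h2im : (x ^ 2).im ≤ 0) (h2re : 0 < (x ^ 2).re)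
    (h4 : (x ^ 4).re ≤ 0) : f j x < f 2 x := by
  have hx2 : ‖x ^ 2‖ < 1 := by
    rw [norm_pow]
    exact pow_lt_one₀ (norm_nonneg _) hx two_ne_zero
  have hr : 0 < ‖x ^ 2‖ := norm_pos_iff.2 fun h => by simp [h] at h2re
  have hr2 := pow_le_of_le_one hr.le hx2.le two_ne_zero
  have hB := f_sq_le_of_four_le_of_re_pow_nonpos hx h4 hj
  rw [show ‖x‖ ^ 4 = ‖x ^ 2‖ ^ 2 by rw [norm_pow]; ring] at hB
  rw [show x ^ 4 = (x ^ 2) ^ 2 by ring, re_sq] at h4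
  have hnorm := norm_sq_eq_re_sq_add_im_sq (x ^ 2)
  have hle_im : 0.707 * ‖x ^ 2‖ ≤ -(x ^ 2).im :=
    le_of_sq_le_sq (by rw [mul_pow, neg_sq]; linarith [sq_nonneg ‖x ^ 2‖]) (by linarith)
  have hnorm_le := norm_le_abs_re_add_abs_im (x ^ 2)
  rw [abs_of_pos h2re, abs_of_nonpos h2im] at hnorm_le
  have hLi_re := re_sub_le_re_Li2 hx2
  have hLi_im := im_Li2_le_mul_im hx2 h2im (c := 0.828) (D := 1.4143) (by norm_num)
    (by linarith) (by norm_num)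
  refine f_lt_f_of_le_of_lt two_pos (-1.5) hB ?_
  push_cast
  linarith

lemma f_lt_f_two_of_re_pow_four_pos (h2 : 0 < (x ^ 2).re) (h4 : 0 < (x ^ 4).re) :
    f j x < f 2 x := by
  have hx2 : ‖x ^ 2‖ < 1 := by
    rw [norm_pow]
    exact pow_lt_one₀ (norm_nonneg _) hx two_ne_zero
  have hr : 0 < ‖x ^ 2‖ := norm_pos_iff.2 fun h => by simp [h] at h2
  have hr2 := pow_le_of_le_one hr.le hx2.le two_ne_zero
  have hB := f_sq_le_of_four_le hx hj
  rw [show ‖x‖ ^ 4 = ‖x ^ 2‖ ^ 2 by rw [norm_pow]; ring] at hB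
  rw [show x ^ 4 = (x ^ 2) ^ 2 by ring, re_sq] at h4
  have hnorm := norm_sq_eq_re_sq_add_im_sq (x ^ 2)
  have hle_re : 0.707 * ‖x ^ 2‖ ≤ (x ^ 2).re :=
    le_of_sq_le_sq (by rw [mul_pow]; linarith [sq_nonneg ‖x ^ 2‖]) h2.le
  have hLi_re := re_sub_le_re_Li2 hx2
  refine f_lt_f_of_le_of_lt two_pos 0 hB ?_
  push_cast
  linarith

end Sectors

theorem f_lt_f_one_or_f_two {x : ℂ} (hx : x ∈ upperHalfDisk) {j : ℕ} (hj : 4 ≤ j) :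
    f j x < f 1 x ∨ f j x < f 2 x := by
  obtain ⟨hx1, him⟩ := hx
  rcases le_or_gt 0 x.re with hre | hre
  · exact .inl (f_lt_f_one_of_re_nonneg hx1 hj him hre)
  rcases le_or_gt (x ^ 2).re 0 with h2 | h2 <;> rcases le_or_gt (x ^ 4).re 0 with h4 | h4
  · exact .inl (f_lt_f_one_of_re_pow_four_nonpos hx1 hj him hre h2 h4)
  · exact .inl (f_lt_f_one_of_re_pow_four_pos hx1 hj him hre h2 h4)
  · refine .inr (f_lt_f_two_of_re_pow_four_nonpos hx1 hj ?_ h2 h4)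
    rw [pow_two, mul_im]
    nlinarith
  · exact .inr (f_lt_f_two_of_re_pow_four_pos hx1 hj h2 h4)

/-! ### The generating function -/

/-- `∑_{m ≥ 1} (x^m / m) q^m / (1 - q^m)`, the logarithm of `∏_{i ≥ 1} (1 - x q^i)⁻¹`. -/
def logGen (x q : ℂ) : ℂ :=
  ∑' m : ℕ, x ^ (m + 1) / ((m : ℂ) + 1) * (q ^ (m + 1) / (1 - q ^ (m + 1)))

lemma norm_pow_mul_div_succ_le {x q : ℂ} (hq : ‖q‖ ≤ 1) (i m : ℕ) :
    ‖(x * q ^ (i + 1)) ^ (m + 1) / ((m : ℂ) + 1)‖ ≤ ‖q‖ ^ (i + 1) * ‖x‖ ^ (m + 1) := by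
  rw [norm_div, norm_natCast_succ, norm_pow, norm_mul, norm_pow, mul_pow, mul_comm (‖q‖ ^ _)]
  refine (div_le_self (by positivity) (by simp)).trans ?_
  gcongr
  rw [← pow_mul]
  exact pow_le_pow_of_le_one (norm_nonneg _) hq (Nat.le_mul_of_pos_right _ m.succ_pos)

lemma summable_pow_succ {r : ℝ} (h0 : 0 ≤ r) (h1 : r < 1) : Summable fun m : ℕ => r ^ (m + 1) :=
  (summable_nat_add_iff 1).2 (summable_geometric_of_lt_one h0 h1)

lemma norm_mul_pow_lt_one {x q : ℂ} (hx : ‖x‖ < 1) (hq : ‖q‖ ≤ 1) (i : ℕ) : ‖x * q ^ i‖ < 1 := by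
  rw [norm_mul, norm_pow]
  exact mul_lt_one_of_nonneg_of_lt_one_left (norm_nonneg _) hx (pow_le_one₀ (norm_nonneg _) hq)

lemma norm_log_one_sub_mul_pow_le {x q : ℂ} (hx : ‖x‖ < 1) (hq : ‖q‖ ≤ 1) (i : ℕ) :
    ‖-log (1 - x * q ^ (i + 1))‖ ≤ ‖q‖ ^ (i + 1) * ∑' m : ℕ, ‖x‖ ^ (m + 1) := by
  rw [← (hasSum_taylorSeries_neg_log' (norm_mul_pow_lt_one hx hq (i + 1))).tsum_eq,
    ← tsum_mul_left]
  exact tsum_of_norm_bounded ((summable_pow_succ (norm_nonneg _) hx).mul_left _).hasSum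
    fun m => norm_pow_mul_div_succ_le hq i m

lemma logGen_eq_tsum {x q : ℂ} (hx : ‖x‖ < 1) (hq : ‖q‖ < 1) :
    logGen x q = ∑' i : ℕ, -log (1 - x * q ^ (i + 1)) := by
  have summable_double : Summable (Function.uncurry fun i m : ℕ =>
      (x * q ^ (i + 1)) ^ (m + 1) / ((m : ℂ) + 1)) :=
    Summable.of_norm_bounded (g := fun p : ℕ × ℕ => ‖q‖ ^ (p.1 + 1) * ‖x‖ ^ (p.2 + 1))
      ((summable_pow_succ (norm_nonneg _) hq).mul_of_nonneg (summable_pow_succ (norm_nonneg _) hx)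
        (fun _ => by positivity) fun _ => by positivity)
      fun p => norm_pow_mul_div_succ_le hq.le p.1 p.2
  have geometric (m : ℕ) : x ^ (m + 1) / ((m : ℂ) + 1) * (q ^ (m + 1) / (1 - q ^ (m + 1))) =
      ∑' i : ℕ, (x * q ^ (i + 1)) ^ (m + 1) / ((m : ℂ) + 1) := by
    have hqm : ‖q ^ (m + 1)‖ < 1 := by
      rw [norm_pow]
      exact pow_lt_one₀ (norm_nonneg _) hq m.succ_ne_zero
    rw [div_eq_mul_inv (q ^ (m + 1)), ← tsum_geometric_of_norm_lt_one hqm, ← tsum_mul_left,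
      ← tsum_mul_left]
    refine tsum_congr fun i => ?_
    rw [mul_pow, ← pow_mul, ← pow_mul, ← pow_add,
      show (i + 1) * (m + 1) = m + 1 + (m + 1) * i by ring]
    ring
  rw [logGen, tsum_congr geometric, summable_double.tsum_comm]
  exact tsum_congr fun i =>
    (hasSum_taylorSeries_neg_log' (norm_mul_pow_lt_one hx hq.le (i + 1))).tsum_eq

lemma hasSum_logGen {x q : ℂ} (hx : ‖x‖ < 1) (hq : ‖q‖ < 1) :
    HasSum (fun i : ℕ => -log (1 - x * q ^ (i + 1))) (logGen x q) := by
  rw [logGen_eq_tsum hx hq]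
  exact (Summable.of_norm_bounded ((summable_pow_succ (norm_nonneg _) hq).mul_right _)
    fun i => norm_log_one_sub_mul_pow_le hx hq.le i).hasSum

lemma exp_sum_neg_log {x q : ℂ} (hx : ‖x‖ < 1) (hq : ‖q‖ ≤ 1) (N : ℕ) :
    exp (∑ i ∈ Finset.range N, -log (1 - x * q ^ (i + 1))) =
      ∏ i ∈ Finset.range N, (1 - x * q ^ (i + 1))⁻¹ := by
  rw [exp_sum]
  refine Finset.prod_congr rfl fun i _ => ?_
  rw [exp_neg, exp_log (one_sub_ne_zero (norm_mul_pow_lt_one hx hq _))]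

lemma norm_prod_inv_le {x q : ℂ} (hx : ‖x‖ < 1) (hq : ‖q‖ < 1) (N : ℕ) :
    ‖∏ i ∈ Finset.range N, (1 - x * q ^ (i + 1))⁻¹‖ ≤
      Real.exp (∑' i : ℕ, ‖q‖ ^ (i + 1) * ∑' m : ℕ, ‖x‖ ^ (m + 1)) := by
  have : 0 ≤ ∑' m : ℕ, ‖x‖ ^ (m + 1) := tsum_nonneg fun m => by positivity
  rw [← exp_sum_neg_log hx hq.le, norm_exp, Real.exp_le_exp]
  calc (∑ i ∈ Finset.range N, -log (1 - x * q ^ (i + 1))).re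
      ≤ ∑ i ∈ Finset.range N, ‖-log (1 - x * q ^ (i + 1))‖ :=
        (re_le_norm _).trans (norm_sum_le _ _)
    _ ≤ ∑ i ∈ Finset.range N, ‖q‖ ^ (i + 1) * ∑' m : ℕ, ‖x‖ ^ (m + 1) :=
        Finset.sum_le_sum fun i _ => norm_log_one_sub_mul_pow_le hx hq.le i
    _ ≤ ∑' i : ℕ, ‖q‖ ^ (i + 1) * ∑' m : ℕ, ‖x‖ ^ (m + 1) :=
        ((summable_pow_succ (norm_nonneg _) hq).mul_right _).sum_le_tsum _
          fun i _ => by positivity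

lemma tendsto_prod_inv {x q : ℂ} (hx : ‖x‖ < 1) (hq : ‖q‖ < 1) :
    Tendsto (fun N : ℕ => ∏ i ∈ Finset.range N, (1 - x * q ^ (i + 1))⁻¹) atTop
      (𝓝 (exp (logGen x q))) := by
  simp_rw [← exp_sum_neg_log hx hq.le]
  exact (continuous_exp.tendsto _).comp (hasSum_logGen hx hq).tendsto_sum_nat

/-- The power series `φ` converges to `g` on the open unit disk. -/
def Represents (φ : PowerSeries ℂ) (g : ℂ → ℂ) : Prop :=
  ∀ q : ℂ, ‖q‖ < 1 → HasSum (fun n => φ.coeff n * q ^ n) (g q)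

lemma Represents.one : Represents 1 fun _ => 1 := by
  intro q _
  refine (hasSum_ite_eq 0 (1 : ℂ)).congr_fun fun n => ?_
  rw [PowerSeries.coeff_one]
  split_ifs with h <;> simp [h]

lemma Represents.mul {φ ψ : PowerSeries ℂ} {g h : ℂ → ℂ} (hφ : Represents φ g)
    (hψ : Represents ψ h) : Represents (φ * ψ) fun q => g q * h q := by
  intro q hq
  have coeff_eq (n : ℕ) : (φ * ψ).coeff n * q ^ n = ∑ kl ∈ Finset.HasAntidiagonal.antidiagonal n,
      (φ.coeff kl.1 * q ^ kl.1) * (ψ.coeff kl.2 * q ^ kl.2) := by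
    rw [PowerSeries.coeff_mul, Finset.sum_mul]
    refine Finset.sum_congr rfl fun p hp => ?_
    rw [← Finset.HasAntidiagonal.mem_antidiagonal.1 hp, pow_add]
    ring
  have hφn := (hφ q hq).summable.norm
  have hψn := (hψ q hq).summable.norm
  simp_rw [coeff_eq]
  rw [← (hφ q hq).tsum_eq, ← (hψ q hq).tsum_eq,
    tsum_mul_tsum_eq_tsum_sum_antidiagonal_of_summable_norm hφn hψn]
  exact (summable_norm_sum_mul_antidiagonal_of_summable_norm hφn hψn).of_norm.hasSum

lemma Represents.prod {φ : ℕ → PowerSeries ℂ} {g : ℕ → ℂ → ℂ} (h : ∀ i, Represents (φ i) (g i))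
    (N : ℕ) : Represents (∏ i ∈ Finset.range N, φ i) fun q => ∏ i ∈ Finset.range N, g i q := by
  induction N with
  | zero => simpa using Represents.one
  | succ N ih =>
    simp_rw [Finset.prod_range_succ]
    exact ih.mul (h N)

open scoped PowerSeries.WithPiTopology in
/-- The factor `1 + ∑_{j ≥ 1} x^j X^{(i+1)j}` of the generating function of partitions whose
parts are weighted by `x`. -/
def genFunFactor (x : ℂ) (i : ℕ) : PowerSeries ℂ :=
  1 + ∑' j : ℕ, x ^ (j + 1) • (PowerSeries.X : PowerSeries ℂ) ^ ((i + 1) * (j + 1))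

open scoped PowerSeries.WithPiTopology in
lemma coeff_genFunFactor (x : ℂ) (i n : ℕ) :
    (genFunFactor x i).coeff n = if (i + 1) ∣ n then x ^ (n / (i + 1)) else 0 := by
  rw [genFunFactor, map_add, (Nat.Partition.summable_genFun_term (fun _ c => x ^ c) i).map_tsum _
    (PowerSeries.WithPiTopology.continuous_coeff _ _)]
  simp only [map_smul, PowerSeries.coeff_X_pow, PowerSeries.coeff_one, smul_eq_mul, mul_ite,
    mul_one, mul_zero]
  rcases n.eq_zero_or_pos with rfl | hn
  · simp
  rw [if_neg hn.ne', zero_add]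
  split_ifs with h
  · obtain ⟨c, rfl⟩ := h
    obtain ⟨c, rfl⟩ := Nat.exists_eq_add_one_of_ne_zero (n := c) (by rintro rfl; simp at hn)
    rw [tsum_eq_single c fun b hb => if_neg fun h => hb ?_]
    · simp
    · have := Nat.eq_of_mul_eq_mul_left i.succ_pos h
      lia
  · refine (tsum_congr fun j => if_neg ?_).trans tsum_zero
    rintro rfl
    exact h (dvd_mul_right _ _)

lemma represents_genFunFactor {x : ℂ} (hx : ‖x‖ < 1) (i : ℕ) :
    Represents (genFunFactor x i) fun q => (1 - x * q ^ (i + 1))⁻¹ := by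
  intro q hq
  have mul_injective : Function.Injective fun c : ℕ => (i + 1) * c :=
    mul_right_injective₀ i.succ_ne_zero
  rw [← mul_injective.hasSum_iff]
  · refine (hasSum_geometric_of_norm_lt_one
      (norm_mul_pow_lt_one hx hq.le (i + 1))).congr_fun fun c => ?_
    rw [Function.comp_apply, coeff_genFunFactor, if_pos (dvd_mul_right _ _),
      Nat.mul_div_cancel_left _ i.succ_pos, mul_pow, pow_mul]
  · intro n hn
    rw [coeff_genFunFactor, if_neg fun ⟨c, hc⟩ => hn ⟨c, hc.symm⟩, zero_mul]

lemma card_parts_mem_Icc {n : ℕ} (hn : 1 ≤ n) (p : n.Partition) :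
    p.parts.card ∈ Finset.Icc 1 n := by
  rw [Finset.mem_Icc, Nat.one_le_iff_ne_zero, Ne, Multiset.card_eq_zero]
  constructor
  · intro h
    have := p.parts_sum
    simp only [h, Multiset.sum_zero] at this
    lia
  · simpa [p.parts_sum] using
      Multiset.card_nsmul_le_sum (s := p.parts) (a := 1) fun y hy => p.parts_pos hy

lemma coeff_genFun_eq_eval_F (x : ℂ) {n : ℕ} (hn : 1 ≤ n) :
    (Nat.Partition.genFun fun _ c => x ^ c).coeff n = (F n).eval x := by
  have weight_eq (p : n.Partition) :
      (p.parts.toFinsupp.prod fun _ c => x ^ c) = x ^ p.parts.card := by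
    rw [Finsupp.prod, Finset.prod_pow_eq_pow_sum]
    simp [Multiset.toFinsupp_support]
  simp_rw [Nat.Partition.coeff_genFun, weight_eq]
  rw [← Finset.sum_fiberwise_of_maps_to fun p _ => card_parts_mem_Icc hn p, F,
    Polynomial.eval_finsetSum]
  refine Finset.sum_congr rfl fun k _ => ?_
  rw [Finset.sum_congr rfl fun p hp => by rw [(Finset.mem_filter.1 hp).2]]
  simp [numPartitions]

open scoped PowerSeries.WithPiTopology in
lemma tendsto_coeff_prod_genFunFactor (x : ℂ) {n : ℕ} (hn : 1 ≤ n) :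
    Tendsto (fun N : ℕ => (∏ i ∈ Finset.range N, genFunFactor x i).coeff n) atTop
      (𝓝 ((F n).eval x)) := by
  rw [← coeff_genFun_eq_eval_F x hn]
  exact (PowerSeries.WithPiTopology.tendsto_iff_coeff_tendsto _ _ _ _).1
    (Nat.Partition.hasProd_genFun (R := ℂ) fun _ c => x ^ c).tendsto_prod_nat n

/-! ### Coefficient extraction -/

/-- The point `e^{-σ + iθ}` of the circle of radius `e^{-σ}`. -/
def circlePt (σ θ : ℝ) : ℂ := exp (-(σ : ℂ) + θ * I)

lemma norm_circlePt (σ θ : ℝ) : ‖circlePt σ θ‖ = Real.exp (-σ) := by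
  simp [circlePt, norm_exp]

lemma norm_circlePt_lt_one {σ : ℝ} (hσ : 0 < σ) (θ : ℝ) : ‖circlePt σ θ‖ < 1 := by
  simpa [norm_circlePt] using hσ

lemma continuous_circlePt (σ : ℝ) : Continuous (circlePt σ) := by
  unfold circlePt
  fun_prop

lemma norm_exp_natCast_mul (n : ℕ) (σ θ : ℝ) : ‖exp (n * (σ - θ * I))‖ = Real.exp (n * σ) := by
  simp [norm_exp]

lemma integral_circlePt_pow (σ a : ℝ) (m n : ℕ) :
    ∫ θ in a..a + 2 * π, circlePt σ θ ^ m * exp (n * (σ - θ * I)) =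
      if m = n then (2 * π : ℂ) else 0 := by
  have integrand_eq (θ : ℝ) : circlePt σ θ ^ m * exp (n * (σ - θ * I)) =
      exp (((n : ℂ) - m) * σ) * exp ((((m : ℂ) - n) * I) * θ) := by
    rw [circlePt, ← exp_nat_mul, ← exp_add, ← exp_add]
    ring_nf
  simp_rw [integrand_eq]
  rw [intervalIntegral.integral_const_mul]
  split_ifs with hmn
  · simp [hmn]
  · have hc : ((m : ℂ) - n) * I ≠ 0 := mul_ne_zero (sub_ne_zero.2 (by exact_mod_cast hmn)) I_ne_zero
    have periodic : exp (((m : ℂ) - n) * I * ((a + 2 * π : ℝ) : ℂ)) =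
        exp (((m : ℂ) - n) * I * a) := by
      rw [exp_eq_exp_iff_exists_int]
      refine ⟨(m : ℤ) - n, ?_⟩
      push_cast
      ring
    rw [integral_exp_mul_complex hc, periodic, sub_self, zero_div, mul_zero]

lemma Represents.integral_eq {φ : PowerSeries ℂ} {g : ℂ → ℂ} (h : Represents φ g) {σ : ℝ}
    (hσ : 0 < σ) (a : ℝ) (n : ℕ) :
    ∫ θ in a..a + 2 * π, g (circlePt σ θ) * exp (n * (σ - θ * I)) = 2 * π * φ.coeff n := by
  have hsum := intervalIntegral.hasSum_integral_of_dominated_convergence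
    (μ := MeasureTheory.volume) (a := a) (b := a + 2 * π)
    (F := fun (m : ℕ) θ => φ.coeff m * (circlePt σ θ ^ m * exp (n * (σ - θ * I))))
    (f := fun θ => g (circlePt σ θ) * exp (n * (σ - θ * I)))
    (fun m _ => ‖φ.coeff m * circlePt σ 0 ^ m‖ * Real.exp (n * σ)) ?_ ?_ ?_ ?_ ?_
  · simp_rw [intervalIntegral.integral_const_mul, integral_circlePt_pow, mul_ite, mul_zero] at hsum
    rw [hsum.unique (hasSum_single n fun m hm => if_neg hm), if_pos rfl]
    ring
  · intro m
    have := continuous_circlePt σ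
    exact Continuous.aestronglyMeasurable (by fun_prop)
  · refine fun m => .of_forall fun θ _ => le_of_eq ?_
    rw [norm_mul, norm_mul, norm_mul, norm_pow, norm_pow, norm_circlePt, norm_circlePt,
      norm_exp_natCast_mul, mul_assoc]
  · exact .of_forall fun θ _ => (h _ (norm_circlePt_lt_one hσ 0)).summable.norm.mul_right _
  · exact intervalIntegrable_const
  · refine .of_forall fun θ _ => ?_
    simpa only [mul_assoc] using (h _ (norm_circlePt_lt_one hσ θ)).mul_right (exp (n * (σ - θ * I)))

theorem integral_exp_logGen {x : ℂ} (hx : ‖x‖ < 1) {σ : ℝ} (hσ : 0 < σ) (a : ℝ) {n : ℕ}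
    (hn : 1 ≤ n) :
    ∫ θ in a..a + 2 * π, exp (logGen x (circlePt σ θ)) * exp (n * (σ - θ * I)) =
      2 * π * (F n).eval x := by
  refine tendsto_nhds_unique ?_ ((tendsto_coeff_prod_genFunFactor x hn).const_mul (2 * π : ℂ))
  simp_rw [← (Represents.prod (represents_genFunFactor hx) _).integral_eq hσ a n]
  refine intervalIntegral.tendsto_integral_filter_of_dominated_convergence
    (fun _ => Real.exp (∑' i : ℕ, Real.exp (-σ) ^ (i + 1) * ∑' m : ℕ, ‖x‖ ^ (m + 1)) *
      Real.exp (n * σ)) ?_ ?_ ?_ ?_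
  · refine .of_forall fun N => Continuous.aestronglyMeasurable ?_
    have := continuous_circlePt σ
    refine (continuous_finsetProd _ fun i _ => ?_).mul (by fun_prop)
    exact Continuous.inv₀ (by fun_prop) fun θ =>
      one_sub_ne_zero (norm_mul_pow_lt_one hx (norm_circlePt_lt_one hσ θ).le _)
  · refine .of_forall fun N => .of_forall fun θ _ => ?_
    have := norm_prod_inv_le hx (norm_circlePt_lt_one hσ θ) N
    rw [norm_circlePt] at this
    rw [norm_mul, norm_exp_natCast_mul]
    gcongr
  · exact intervalIntegrable_const
  · exact .of_forall fun θ _ =>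
      (tendsto_prod_inv hx (norm_circlePt_lt_one hσ θ)).mul_const _

/-! ### The kernel `1 / (ξ e^z - 1)` -/

/-- The sector around the positive real axis with slope `M`. -/
def sector (M : ℝ) : Set ℂ := {z | 0 < z.re ∧ |z.im| ≤ M * z.re}

lemma ne_zero_of_re_pos {z : ℂ} (hz : 0 < z.re) : z ≠ 0 := by
  rintro rfl
  simp at hz

lemma norm_le_of_mem_sector {M : ℝ} {z : ℂ} (hz : z ∈ sector M) : ‖z‖ ≤ (1 + M) * z.re := by
  have := norm_le_abs_re_add_abs_im z
  rw [abs_of_pos hz.1] at this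
  linarith [hz.2]

lemma natCast_succ_mul_mem_sector {M : ℝ} {z : ℂ} (hz : z ∈ sector M) (m : ℕ) :
    ((m : ℂ) + 1) * z ∈ sector M := by
  have hm : (0 : ℝ) < m + 1 := by positivity
  have hre : (((m : ℂ) + 1) * z).re = (m + 1) * z.re := by simp
  have him : (((m : ℂ) + 1) * z).im = (m + 1) * z.im := by simp
  constructor
  · rw [hre]
    exact mul_pos hm hz.1
  · rw [hre, him, abs_mul, abs_of_pos hm, mul_left_comm]
    exact mul_le_mul_of_nonneg_left hz.2 hm.le

lemma ofReal_sub_mul_I_mem_sector {M σ φ : ℝ} (hσ : 0 < σ) (hφ : |φ| ≤ M * σ) :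
    (σ - φ * I : ℂ) ∈ sector M := by
  simpa [sector] using ⟨hσ, hφ⟩

lemma re_le_norm_mul_exp_sub_one {ξ : ℂ} (hξ : ‖ξ‖ = 1) (z : ℂ) : z.re ≤ ‖ξ * exp z - 1‖ :=
  calc z.re ≤ Real.exp z.re - 1 := by linarith [Real.add_one_le_exp z.re]
    _ = ‖ξ * exp z‖ - ‖(1 : ℂ)‖ := by rw [norm_mul, hξ, one_mul, norm_exp, norm_one]
    _ ≤ ‖ξ * exp z - 1‖ := norm_sub_norm_le _ _

lemma norm_one_div_mul_exp_sub_one_le {ξ z : ℂ} (hξ : ‖ξ‖ = 1) (hz : 0 < z.re) :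
    ‖1 / (ξ * exp z - 1)‖ ≤ 1 / z.re := by
  rw [norm_div, norm_one]
  exact one_div_le_one_div_of_le hz (re_le_norm_mul_exp_sub_one hξ z)

/-- The terms of degree at most zero in the Laurent expansion of `1 / (ξ e^z - 1)` at `z = 0`. -/
def kernelExpansion (ξ z : ℂ) : ℂ := if ξ = 1 then 1 / z - 1 / 2 else 1 / (ξ - 1)

lemma half_norm_le_norm_exp_sub_one {z : ℂ} (hz : ‖z‖ ≤ 1 / 2) : ‖z‖ / 2 ≤ ‖exp z - 1‖ := by
  have linear := norm_exp_sub_one_sub_id_le (x := z) (by linarith)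
  have triangle : ‖z‖ - ‖exp z - 1‖ ≤ ‖z - (exp z - 1)‖ := norm_sub_norm_le _ _
  rw [norm_sub_rev z] at triangle
  nlinarith [norm_nonneg z]

lemma norm_one_div_exp_sub_one_sub_le {z : ℂ} (hz0 : z ≠ 0) (hz : ‖z‖ ≤ 1 / 2) :
    ‖1 / (exp z - 1) - (1 / z - 1 / 2)‖ ≤ 2 * ‖z‖ := by
  have hn : 0 < ‖z‖ := norm_pos_iff.2 hz0
  have lower := half_norm_le_norm_exp_sub_one hz
  have hne : exp z - 1 ≠ 0 := norm_pos_iff.1 (by linarith)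
  obtain ⟨R, hexp, hR⟩ : ∃ R, exp z = 1 + z + z ^ 2 / 2 + R ∧ ‖R‖ ≤ ‖z‖ ^ 3 * (2 / 9) := by
    have taylor := exp_bound (x := z) (by linarith) (n := 3) (by norm_num)
    refine ⟨_, ?_, taylor.trans (by norm_num [Nat.factorial])⟩
    simp [Finset.sum_range_succ, Nat.factorial]
  have remainder_eq : 1 / (exp z - 1) - (1 / z - 1 / 2) =
      (-R + z ^ 3 / 4 + z * R / 2) / (z * (exp z - 1)) := by
    field_simp
    rw [hexp]
    ring
  have numerator_le : ‖-R + z ^ 3 / 4 + z * R / 2‖ ≤ ‖R‖ + ‖z‖ ^ 3 / 4 + ‖z‖ * ‖R‖ / 2 := by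
    refine norm_add₃_le.trans_eq ?_
    simp only [norm_neg, norm_div, norm_mul, norm_pow, norm_ofNat]
  have product_le : ‖z‖ * ‖R‖ ≤ 1 / 2 * ‖R‖ := by gcongr
  rw [remainder_eq, norm_div, norm_mul, div_le_iff₀ (by positivity)]
  calc ‖-R + z ^ 3 / 4 + z * R / 2‖ ≤ ‖z‖ ^ 3 := by nlinarith [pow_pos hn 3]
    _ = 2 * ‖z‖ * (‖z‖ * (‖z‖ / 2)) := by ring
    _ ≤ 2 * ‖z‖ * (‖z‖ * ‖exp z - 1‖) := by gcongr

lemma kernel_sub_kernelExpansion_isBigO (ξ : ℂ) :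
    (fun z => 1 / (ξ * exp z - 1) - kernelExpansion ξ z) =O[𝓝[≠] 0] fun z => z := by
  unfold kernelExpansion
  split_ifs with hξ
  · subst hξ
    refine Asymptotics.IsBigO.of_bound 2 ?_
    filter_upwards [self_mem_nhdsWithin, mem_nhdsWithin_of_mem_nhds
      (Metric.closedBall_mem_nhds (0 : ℂ) one_half_pos)] with z hz0 hz
    simpa only [one_mul] using norm_one_div_exp_sub_one_sub_le hz0 (mem_closedBall_zero_iff.1 hz)
  · have hdiff : DifferentiableAt ℂ (fun z => 1 / (ξ * exp z - 1)) 0 := by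
      refine DifferentiableAt.div (by fun_prop) (by fun_prop) ?_
      simpa using sub_ne_zero.2 hξ
    simpa using hdiff.hasDerivAt.isBigO_sub.mono nhdsWithin_le_nhds

lemma norm_kernelExpansion_le (ξ : ℂ) {δ : ℝ} (hδ : 0 < δ) {z : ℂ} (hz : δ ≤ ‖z‖) :
    ‖kernelExpansion ξ z‖ ≤ 1 / δ + 1 / 2 + ‖1 / (ξ - 1)‖ := by
  unfold kernelExpansion
  split_ifs with hξ
  · have : ‖1 / z‖ ≤ 1 / δ := by
      rw [norm_div, norm_one]
      gcongr
    have half : ‖(1 / 2 : ℂ)‖ = 1 / 2 := by simp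
    linarith [norm_sub_le (1 / z) (1 / 2), norm_nonneg (1 / (ξ - 1))]
  · have : 0 < 1 / δ := by positivity
    linarith

lemma exists_norm_kernel_sub_le {ξ : ℂ} (hξ : ‖ξ‖ = 1) {M : ℝ} (hM : 0 ≤ M) :
    ∃ C : ℝ, ∀ z ∈ sector M, ‖1 / (ξ * exp z - 1) - kernelExpansion ξ z‖ ≤ C * ‖z‖ := by
  obtain ⟨c, hc⟩ := (kernel_sub_kernelExpansion_isBigO ξ).bound
  obtain ⟨δ, hδ, near⟩ := Metric.mem_nhdsWithin_iff.1 hc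
  set B := (1 + M) / δ + (1 / δ + 1 / 2 + ‖1 / (ξ - 1)‖)
  refine ⟨max c (B / δ), fun z hz => ?_⟩
  have hn : 0 < ‖z‖ := norm_pos_iff.2 (ne_zero_of_re_pos hz.1)
  rcases lt_or_ge ‖z‖ δ with hlt | hge
  · refine (near ⟨mem_ball_zero_iff.2 hlt, ne_zero_of_re_pos hz.1⟩).trans ?_
    gcongr
    exact le_max_left _ _
  · have kernel_le : ‖1 / (ξ * exp z - 1)‖ ≤ (1 + M) / δ :=
      calc ‖1 / (ξ * exp z - 1)‖ ≤ 1 / z.re := norm_one_div_mul_exp_sub_one_le hξ hz.1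
        _ ≤ (1 + M) / ‖z‖ := by
          rw [div_le_div_iff₀ hz.1 hn, one_mul]
          exact norm_le_of_mem_sector hz
        _ ≤ (1 + M) / δ := by gcongr
    calc ‖1 / (ξ * exp z - 1) - kernelExpansion ξ z‖
        ≤ B := (norm_sub_le _ _).trans (add_le_add kernel_le (norm_kernelExpansion_le ξ hδ hge))
      _ = B / δ * δ := by field_simp
      _ ≤ max c (B / δ) * ‖z‖ := by
        gcongr
        exact le_max_right _ _

lemma finite_setOf_pow_eq_one {k : ℕ} (hk : 0 < k) : {ξ : ℂ | ξ ^ k = 1}.Finite :=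
  (Polynomial.nthRootsFinset k (1 : ℂ)).finite_toSet.subset fun ξ hξ => by
    simpa [Polynomial.mem_nthRootsFinset hk] using hξ

lemma exists_forall_pow_eq_one_le {k : ℕ} (hk : 0 < k) (g : ℂ → ℝ) :
    ∃ C : ℝ, ∀ ξ : ℂ, ξ ^ k = 1 → g ξ ≤ C := by
  obtain ⟨C, hC⟩ := ((finite_setOf_pow_eq_one hk).image g).bddAbove
  exact ⟨C, fun ξ hξ => hC ⟨ξ, hξ, rfl⟩⟩

lemma exists_forall_pow_eq_one_norm_kernel_sub_le {k : ℕ} (hk : 0 < k) {M : ℝ} (hM : 0 ≤ M) :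
    ∃ C : ℝ, ∀ ξ : ℂ, ξ ^ k = 1 → ∀ z ∈ sector M,
      ‖1 / (ξ * exp z - 1) - kernelExpansion ξ z‖ ≤ C * ‖z‖ := by
  choose! c hc using fun (ξ : ℂ) (hξ : ‖ξ‖ = 1) => exists_norm_kernel_sub_le hξ hM
  obtain ⟨C, hC⟩ := exists_forall_pow_eq_one_le hk c
  refine ⟨C, fun ξ hξ z hz => (hc ξ (norm_eq_one_of_pow_eq_one hξ hk.ne') z hz).trans ?_⟩
  gcongr
  exact hC ξ hξ

/-! ### The expansion of the generating function at a root of unity -/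

lemma hasSum_multiples {a : ℕ → ℂ} {s : ℂ} {k : ℕ} (hk : 0 < k)
    (h : HasSum (fun c : ℕ => a (k * (c + 1))) s) :
    HasSum (fun m : ℕ => if k ∣ m + 1 then a (m + 1) else 0) s := by
  have hpos (c : ℕ) : 1 ≤ k * (c + 1) := Nat.succ_le_of_lt (by positivity)
  have hinj : Function.Injective fun c : ℕ => k * (c + 1) - 1 := by
    intro b c hbc
    have := Nat.eq_of_mul_eq_mul_left hk (Nat.pred_inj (hpos b) (hpos c) hbc)
    lia
  rw [← hinj.hasSum_iff]
  · refine h.congr_fun fun c => ?_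
    rw [Function.comp_apply, Nat.sub_add_cancel (hpos c), if_pos (dvd_mul_right _ _)]
  · refine fun m hm => if_neg ?_
    rintro ⟨c, hc⟩
    obtain ⟨c, rfl⟩ := Nat.exists_eq_add_one_of_ne_zero (n := c) (by rintro rfl; simp at hc)
    exact hm ⟨c, Nat.sub_eq_of_eq_add hc.symm⟩

lemma L_sq (k : ℕ) (x : ℂ) : L k x ^ 2 = Li2 (x ^ k) / (k : ℂ) ^ 2 := by
  rw [L, div_pow, sq_csqrt]

lemma hasSum_L_sq {x : ℂ} (hx : ‖x‖ < 1) (k : ℕ) :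
    HasSum (fun m : ℕ => if k ∣ m + 1 then x ^ (m + 1) / ((m : ℂ) + 1) ^ 2 else 0)
      (L k x ^ 2) := by
  rcases k.eq_zero_or_pos with rfl | hk
  · simp [L_sq, hasSum_zero]
  have hxk : ‖x ^ k‖ ≤ 1 := by
    rw [norm_pow]
    exact pow_le_one₀ (norm_nonneg _) hx.le
  rw [L_sq]
  have hsum := (summable_norm_Li2_term hxk).of_norm.hasSum.div_const ((k : ℂ) ^ 2)
  refine (hasSum_multiples (a := fun n => x ^ n / (n : ℂ) ^ 2) hk
    (hsum.congr_fun fun c => ?_)).congr_fun fun m => by push_cast; rfl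
  push_cast
  rw [pow_mul, mul_pow, mul_comm ((k : ℂ) ^ 2), div_div]

lemma hasSum_log_multiples {x : ℂ} (hx : ‖x‖ < 1) {k : ℕ} (hk : 0 < k) :
    HasSum (fun m : ℕ => if k ∣ m + 1 then x ^ (m + 1) / ((m : ℂ) + 1) else 0)
      (-log (1 - x ^ k) / k) := by
  have hxk : ‖x ^ k‖ < 1 := by
    rw [norm_pow]
    exact pow_lt_one₀ (norm_nonneg _) hx hk.ne'
  have hsum := (hasSum_taylorSeries_neg_log' hxk).div_const (k : ℂ)
  refine (hasSum_multiples (a := fun n => x ^ n / (n : ℂ)) hk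
    (hsum.congr_fun fun c => ?_)).congr_fun fun m => by push_cast; rfl
  push_cast
  rw [pow_mul, mul_comm (k : ℂ), div_div]

lemma re_natCast_succ_mul (m : ℕ) (σ θ : ℝ) :
    (((m : ℂ) + 1) * (σ - θ * I)).re = (m + 1) * σ := by
  simp

lemma circlePt_pow_div (σ θ : ℝ) (m : ℕ) :
    circlePt σ θ ^ (m + 1) / (1 - circlePt σ θ ^ (m + 1)) =
      1 / (exp (((m : ℂ) + 1) * (σ - θ * I)) - 1) := by
  have hpow : circlePt σ θ ^ (m + 1) = (exp (((m : ℂ) + 1) * (σ - θ * I)))⁻¹ := by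
    rw [circlePt, ← exp_nat_mul, ← exp_neg]
    push_cast
    ring_nf
  have hexp := exp_ne_zero (((m : ℂ) + 1) * (σ - θ * I))
  rw [hpow, inv_eq_one_div, one_sub_div hexp, div_div_div_cancel_right₀ hexp]

lemma norm_kernel_circlePt_le {σ : ℝ} (hσ : 0 < σ) (θ : ℝ) (m : ℕ) :
    ‖1 / (exp (((m : ℂ) + 1) * (σ - θ * I)) - 1)‖ ≤ 1 / ((m + 1) * σ) := by
  have hre := re_natCast_succ_mul m σ θ
  simpa only [one_mul, hre] using norm_one_div_mul_exp_sub_one_le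
    (z := ((m : ℂ) + 1) * (σ - θ * I)) norm_one (by rw [hre]; positivity)

lemma norm_logGen_term_le (x : ℂ) {σ : ℝ} (hσ : 0 < σ) (θ : ℝ) (m : ℕ) :
    ‖x ^ (m + 1) / ((m : ℂ) + 1) * (1 / (exp (((m : ℂ) + 1) * (σ - θ * I)) - 1))‖ ≤
      ‖x‖ ^ (m + 1) / σ := by
  rw [norm_mul, norm_div, norm_pow, norm_natCast_succ]
  calc ‖x‖ ^ (m + 1) / (m + 1) * ‖1 / (exp (((m : ℂ) + 1) * (σ - θ * I)) - 1)‖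
      ≤ ‖x‖ ^ (m + 1) / 1 * (1 / (1 * σ)) := by
        refine mul_le_mul ?_ ((norm_kernel_circlePt_le hσ θ m).trans ?_) (norm_nonneg _)
          (by positivity)
        all_goals
          gcongr
          simp
    _ = ‖x‖ ^ (m + 1) / σ := by ring

lemma hasSum_logGen_circlePt {x : ℂ} (hx : ‖x‖ < 1) {σ : ℝ} (hσ : 0 < σ) (θ : ℝ) :
    HasSum (fun m : ℕ => x ^ (m + 1) / ((m : ℂ) + 1) *
      (1 / (exp (((m : ℂ) + 1) * (σ - θ * I)) - 1))) (logGen x (circlePt σ θ)) := by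
  simp_rw [logGen, circlePt_pow_div]
  exact (Summable.of_norm_bounded ((summable_pow_succ (norm_nonneg _) hx).div_const σ)
    fun m => norm_logGen_term_le x hσ θ m).hasSum

lemma continuous_logGen_circlePt {x : ℂ} (hx : ‖x‖ < 1) {σ : ℝ} (hσ : 0 < σ) :
    Continuous fun θ => logGen x (circlePt σ θ) := by
  simp_rw [logGen, circlePt_pow_div]
  refine continuous_tsum (fun m => ?_) ((summable_pow_succ (norm_nonneg _) hx).div_const σ)
    fun m θ => norm_logGen_term_le x hσ θ m
  refine continuous_const.mul (continuous_const.div (by fun_prop) fun θ => norm_pos_iff.1 ?_)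
  have hre : 0 < (((m : ℂ) + 1) * (σ - θ * I)).re := by
    rw [re_natCast_succ_mul]
    positivity
  simpa only [one_mul] using hre.trans_le (re_le_norm_mul_exp_sub_one norm_one _)

lemma exp_neg_pow_eq_one {k : ℕ} (hk : 0 < k) (h m : ℕ) :
    exp (-2 * π * I * m * h / k) ^ k = 1 := by
  rw [← exp_nat_mul, exp_eq_one_iff]
  refine ⟨-(m * h : ℤ), ?_⟩
  have : (k : ℂ) ≠ 0 := by exact_mod_cast hk.ne'
  push_cast
  field_simp

lemma exp_neg_eq_one_iff {h k : ℕ} (hk : 0 < k) (hc : h.Coprime k) (m : ℕ) :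
    exp (-2 * π * I * m * h / k) = 1 ↔ k ∣ m := by
  rw [← (isPrimitiveRoot_exp_of_coprime h k hk.ne' hc).pow_eq_one_iff_dvd, ← inv_inj, inv_one,
    ← exp_neg, ← exp_nat_mul]
  ring_nf

lemma hasSum_w {x : ℂ} (hx : ‖x‖ < 1) (h : ℕ) {k : ℕ} (hk : 0 < k) :
    HasSum (fun m : ℕ => x ^ (m + 1) / ((m : ℂ) + 1) * if k ∣ m + 1 then -1 / 2 else
      1 / (exp (-2 * π * I * (m + 1 : ℕ) * h / k) - 1)) (w h k x) := by
  obtain ⟨C, hC⟩ := exists_forall_pow_eq_one_le hk fun ξ => ‖1 / (ξ - 1)‖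
  have hC0 : 0 ≤ C := (norm_nonneg _).trans (hC 1 (one_pow k))
  set g : ℕ → ℂ := fun l => if k ∣ l then 0 else
    x ^ l / l * (1 / (exp (-2 * π * I * l * h / k) - 1)) with hg
  have summable_g : Summable g := by
    refine Summable.of_norm_bounded
      ((summable_geometric_of_lt_one (norm_nonneg x) hx).mul_right C) fun l => ?_
    simp only [hg]
    split_ifs with hl
    · rw [norm_zero]
      positivity
    · have hl1 : (1 : ℝ) ≤ l := by
        exact_mod_cast Nat.one_le_iff_ne_zero.2 (by rintro rfl; simp at hl)
      rw [norm_mul, norm_div (x ^ l), norm_pow, norm_natCast]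
      exact mul_le_mul (div_le_self (by positivity) hl1) (hC _ (exp_neg_pow_eq_one hk h l))
        (norm_nonneg _) (by positivity)
  have hasSum_succ : HasSum (fun m : ℕ => g (m + 1)) (∑' l, g l) := by
    simpa [hg] using (hasSum_nat_add_iff' 1).2 summable_g.hasSum
  have w_eq : w h k x = -1 / 2 * (-log (1 - x ^ k) / k) + ∑' l, g l := by
    rw [w]
    congr 1
    ring
  rw [w_eq]
  refine (((hasSum_log_multiples hx hk).mul_left (-1 / 2)).add hasSum_succ).congr_fun fun m => ?_
  simp only [hg]
  split_ifs with hl <;> push_cast <;> ring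

lemma hasSum_kernelExpansion {x : ℂ} (hx : ‖x‖ < 1) {h k : ℕ} (hk : 0 < k) (hc : h.Coprime k)
    (τ : ℂ) :
    HasSum (fun m : ℕ => x ^ (m + 1) / ((m : ℂ) + 1) *
      kernelExpansion (exp (-2 * π * I * (m + 1 : ℕ) * h / k)) (((m : ℂ) + 1) * τ))
      (L k x ^ 2 / τ + w h k x) := by
  refine (((hasSum_L_sq hx k).div_const τ).add (hasSum_w hx h hk)).congr_fun fun m => ?_
  simp only [kernelExpansion, exp_neg_eq_one_iff hk hc]
  split_ifs
  · generalize (m : ℂ) + 1 = a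
    ring
  · ring

theorem exists_logGen_expansion {h k : ℕ} (hk : 0 < k) (hc : h.Coprime k) {M r : ℝ} (hM : 0 ≤ M)
    (hr0 : 0 ≤ r) (hr : r < 1) :
    ∃ C : ℝ, ∀ x : ℂ, ‖x‖ ≤ r → ∀ σ φ : ℝ, 0 < σ → |φ| ≤ M * σ →
      ‖logGen x (circlePt σ (2 * π * h / k + φ)) - (L k x ^ 2 / (σ - φ * I) + w h k x)‖ ≤
        C * ‖(σ - φ * I : ℂ)‖ := by
  obtain ⟨C, hC⟩ := exists_forall_pow_eq_one_norm_kernel_sub_le hk hM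
  refine ⟨∑' m : ℕ, r ^ (m + 1) * C, fun x hx σ φ hσ hφ => ?_⟩
  have hx1 : ‖x‖ < 1 := hx.trans_lt hr
  rw [← ((hasSum_logGen_circlePt hx1 hσ _).sub (hasSum_kernelExpansion hx1 hk hc _)).tsum_eq,
    ← tsum_mul_right]
  refine tsum_of_norm_bounded
    (((summable_pow_succ hr0 hr).mul_right C).mul_right _).hasSum fun m => ?_
  have exp_eq : exp (((m : ℂ) + 1) * (σ - ((2 * π * h / k + φ : ℝ) : ℂ) * I)) =
      exp (-2 * π * I * (m + 1 : ℕ) * h / k) * exp (((m : ℂ) + 1) * (σ - φ * I)) := by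
    rw [← exp_add]
    push_cast
    ring_nf
  have kernel_le := hC _ (exp_neg_pow_eq_one hk h (m + 1)) _
    (natCast_succ_mul_mem_sector (ofReal_sub_mul_I_mem_sector hσ hφ) m)
  rw [exp_eq, ← mul_sub, norm_mul, norm_div, norm_pow, norm_natCast_succ]
  rw [norm_mul ((m : ℂ) + 1), norm_natCast_succ] at kernel_le
  calc _ ≤ r ^ (m + 1) / (m + 1) * (C * ((m + 1) * ‖(σ - φ * I : ℂ)‖)) := by gcongr
    _ = r ^ (m + 1) * C * ‖(σ - φ * I : ℂ)‖ := by field_simp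

/-! ### The growth of the generating function near the unit circle -/

lemma ofReal_sub_mul_I_ne_zero {σ : ℝ} (hσ : 0 < σ) (φ : ℝ) : (σ : ℂ) - φ * I ≠ 0 :=
  ne_zero_of_re_pos (by simpa using hσ)

lemma norm_ofReal_div_sub_le_one {σ : ℝ} (hσ : 0 < σ) (φ : ℝ) :
    ‖(σ : ℂ) / (σ - φ * I)‖ ≤ 1 := by
  have hre : σ ≤ ‖(σ : ℂ) - φ * I‖ := by simpa using re_le_norm ((σ : ℂ) - φ * I)
  rw [norm_div, norm_real, Real.norm_of_nonneg hσ.le]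
  exact div_le_one_of_le₀ hre (norm_nonneg _)

lemma norm_ofReal_div_sub_le_inv {σ φ M : ℝ} (hσ : 0 < σ) (hM : 0 < M) (hφ : M * σ ≤ |φ|) :
    ‖(σ : ℂ) / (σ - φ * I)‖ ≤ M⁻¹ := by
  have him : |φ| ≤ ‖(σ : ℂ) - φ * I‖ := by simpa using abs_im_le_norm ((σ : ℂ) - φ * I)
  rw [norm_div, norm_real, Real.norm_of_nonneg hσ.le,
    div_le_iff₀ (norm_pos_iff.2 (ofReal_sub_mul_I_ne_zero hσ φ)), inv_mul_eq_div, le_div_iff₀' hM]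
  exact hφ.trans him

lemma orderOf_exp_dvd_iff (θ : ℝ) (m : ℕ) :
    orderOf (exp (θ * I)) ∣ m + 1 ↔ exp (-(((m : ℂ) + 1) * (θ * I))) = 1 := by
  rw [orderOf_dvd_iff_pow_eq_one, ← exp_nat_mul, exp_neg, inv_eq_one, Nat.cast_succ]

lemma kernel_sub_pole_isBigO_one (ξ : ℂ) :
    (fun z => 1 / (ξ * exp z - 1) - if ξ = 1 then 1 / z else 0) =O[𝓝[≠] 0]
      fun _ => (1 : ℂ) := by
  have expansion := (kernel_sub_kernelExpansion_isBigO ξ).trans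
    ((tendsto_id.mono_left nhdsWithin_le_nhds).isBigO_one ℂ)
  refine (expansion.add (Asymptotics.isBigO_const_const
    (if ξ = 1 then -(1 / 2) else 1 / (ξ - 1)) one_ne_zero _)).congr_left fun z => ?_
  unfold kernelExpansion
  split_ifs <;> ring

lemma tendsto_mul_kernel_sub_pole (x : ℂ) (θ₀ : ℝ) (m : ℕ) :
    Tendsto (fun p : (ℝ × ℂ) × ℝ =>
      (p.1.1 : ℂ) * (1 / (exp (((m : ℂ) + 1) * (p.1.1 - p.2 * I)) - 1) -
        if orderOf (exp (θ₀ * I)) ∣ m + 1 then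
          1 / (((m : ℂ) + 1) * (p.1.1 - (p.2 - θ₀ : ℝ) * I)) else 0))
      ((𝓝[>] 0 ×ˢ 𝓝 x) ×ˢ 𝓝 θ₀) (𝓝 0) := by
  set l : Filter ((ℝ × ℂ) × ℝ) := (𝓝[>] 0 ×ˢ 𝓝 x) ×ˢ 𝓝 θ₀
  have tendsto_sigma : Tendsto (fun p : (ℝ × ℂ) × ℝ => p.1.1) l (𝓝[>] 0) :=
    tendsto_fst.comp tendsto_fst
  have tendsto_sigma_zero : Tendsto (fun p : (ℝ × ℂ) × ℝ => (p.1.1 : ℂ)) l (𝓝 0) := by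
    simpa using (tendsto_sigma.mono_right nhdsWithin_le_nhds).ofReal
  have tendsto_z : Tendsto (fun p : (ℝ × ℂ) × ℝ =>
      ((m : ℂ) + 1) * (p.1.1 - (p.2 - θ₀ : ℝ) * I)) l (𝓝[≠] 0) := by
    refine tendsto_nhdsWithin_iff.2 ⟨?_, ?_⟩
    · have tendsto_phi : Tendsto (fun p : (ℝ × ℂ) × ℝ => ((p.2 - θ₀ : ℝ) : ℂ)) l (𝓝 0) := by
        simpa only [ofReal_zero] using (tendsto_sub_nhds_zero_iff.2 tendsto_snd).ofReal
      simpa using (tendsto_sigma_zero.sub (tendsto_phi.mul_const I)).const_mul ((m : ℂ) + 1)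
    · filter_upwards [tendsto_sigma.eventually self_mem_nhdsWithin] with p hp
      exact mul_ne_zero (Nat.cast_add_one_ne_zero m) (ofReal_sub_mul_I_ne_zero hp _)
  rw [← Asymptotics.isLittleO_one_iff ℂ] at tendsto_sigma_zero ⊢
  have := tendsto_sigma_zero.mul_isBigO ((kernel_sub_pole_isBigO_one
    (exp (-(((m : ℂ) + 1) * (θ₀ * I))))).comp_tendsto tendsto_z)
  refine this.congr (fun p => ?_) fun _ => one_mul 1
  simp only [Function.comp_apply, orderOf_exp_dvd_iff, ← exp_add]
  push_cast
  ring_nf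

lemma tendsto_logGen_term (x : ℂ) (θ₀ : ℝ) (m : ℕ) :
    Tendsto (fun p : (ℝ × ℂ) × ℝ =>
      (p.1.1 : ℂ) * (p.1.2 ^ (m + 1) / ((m : ℂ) + 1) *
        (1 / (exp (((m : ℂ) + 1) * (p.1.1 - p.2 * I)) - 1))) -
      (p.1.1 : ℂ) / (p.1.1 - (p.2 - θ₀ : ℝ) * I) *
        (if orderOf (exp (θ₀ * I)) ∣ m + 1 then x ^ (m + 1) / ((m : ℂ) + 1) ^ 2 else 0))
      ((𝓝[>] 0 ×ˢ 𝓝 x) ×ˢ 𝓝 θ₀) (𝓝 0) := by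
  set l : Filter ((ℝ × ℂ) × ℝ) := (𝓝[>] 0 ×ˢ 𝓝 x) ×ˢ 𝓝 θ₀
  set c : ℂ := if orderOf (exp (θ₀ * I)) ∣ m + 1 then 1 / ((m : ℂ) + 1) ^ 2 else 0 with hc
  have tendsto_y : Tendsto (fun p : (ℝ × ℂ) × ℝ => p.1.2 ^ (m + 1)) l (𝓝 (x ^ (m + 1))) :=
    (tendsto_snd.comp tendsto_fst).pow (m + 1)
  have tendsto_pole : Tendsto (fun p : (ℝ × ℂ) × ℝ =>
      (p.1.1 : ℂ) / (p.1.1 - (p.2 - θ₀ : ℝ) * I) * (c * (p.1.2 ^ (m + 1) - x ^ (m + 1))))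
      l (𝓝 0) := by
    have bound : Tendsto (fun p : (ℝ × ℂ) × ℝ => ‖c * (p.1.2 ^ (m + 1) - x ^ (m + 1))‖) l
        (𝓝 0) := by
      simpa using ((tendsto_sub_nhds_zero_iff.2 tendsto_y).const_mul c).norm
    refine squeeze_zero_norm' ?_ bound
    filter_upwards [(tendsto_fst.comp tendsto_fst).eventually self_mem_nhdsWithin] with p hp
    rw [norm_mul]
    exact mul_le_of_le_one_left (norm_nonneg _) (norm_ofReal_div_sub_le_one hp _)
  have sum_tendsto := ((tendsto_y.div_const ((m : ℂ) + 1)).mul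
    (tendsto_mul_kernel_sub_pole x θ₀ m)).add tendsto_pole
  rw [mul_zero, add_zero] at sum_tendsto
  refine sum_tendsto.congr fun p => ?_
  simp only [hc]
  generalize (m : ℂ) + 1 = a, (p.1.1 : ℂ) - (p.2 - θ₀ : ℝ) * I = τ
  split_ifs <;> ring

/-- If `e^{iθ₀}` is not a root of unity, then `orderOf` is `0` and the term `L 0 x` vanishes. -/
theorem tendsto_logGen {x : ℂ} (hx : ‖x‖ < 1) (θ₀ : ℝ) :
    Tendsto (fun p : (ℝ × ℂ) × ℝ => (p.1.1 : ℂ) * logGen p.1.2 (circlePt p.1.1 p.2) -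
      (p.1.1 : ℂ) / (p.1.1 - (p.2 - θ₀ : ℝ) * I) * L (orderOf (exp (θ₀ * I))) x ^ 2)
      ((𝓝[>] 0 ×ˢ 𝓝 x) ×ˢ 𝓝 θ₀) (𝓝 0) := by
  obtain ⟨r, hxr, hr⟩ := exists_between hx
  have hr0 : 0 ≤ r := (norm_nonneg x).trans hxr.le
  set l : Filter ((ℝ × ℂ) × ℝ) := (𝓝[>] 0 ×ˢ 𝓝 x) ×ˢ 𝓝 θ₀
  have sigma_pos : ∀ᶠ p : (ℝ × ℂ) × ℝ in l, 0 < p.1.1 :=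
    (tendsto_fst.comp tendsto_fst).eventually self_mem_nhdsWithin
  have norm_lt : ∀ᶠ p : (ℝ × ℂ) × ℝ in l, ‖p.1.2‖ < r :=
    (tendsto_snd.comp tendsto_fst).norm.eventually_lt_const hxr
  have dominated := tendsto_tsum_of_dominated_convergence
    (bound := fun m : ℕ => r ^ (m + 1) + r ^ (m + 1))
    ((summable_pow_succ hr0 hr).add (summable_pow_succ hr0 hr)) (tendsto_logGen_term x θ₀) ?_
  · rw [tsum_zero] at dominated
    refine dominated.congr' ?_
    filter_upwards [sigma_pos, norm_lt] with p hp hy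
    exact (((hasSum_logGen_circlePt (hy.trans hr) hp p.2).mul_left _).sub
      ((hasSum_L_sq hx _).mul_left _)).tsum_eq
  · filter_upwards [sigma_pos, norm_lt] with p hp hy m
    refine (norm_sub_le _ _).trans (add_le_add ?_ ?_)
    · rw [norm_mul, norm_real, Real.norm_of_nonneg hp.le]
      calc _ ≤ p.1.1 * (‖p.1.2‖ ^ (m + 1) / p.1.1) :=
            mul_le_mul_of_nonneg_left (norm_logGen_term_le _ hp p.2 m) hp.le
        _ = ‖p.1.2‖ ^ (m + 1) := mul_div_cancel₀ _ hp.ne'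
        _ ≤ r ^ (m + 1) := by gcongr
    · rw [norm_mul]
      refine (mul_le_of_le_one_left (norm_nonneg _) (norm_ofReal_div_sub_le_one hp _)).trans ?_
      split_ifs
      · rw [norm_div, norm_pow, norm_pow, norm_natCast_succ]
        refine (div_le_self (by positivity) (one_le_pow₀ (by simp))).trans ?_
        gcongr
      · rw [norm_zero]
        positivity

lemma eventually_mul_re_logGen_le {x : ℂ} (hx : ‖x‖ < 1) (θ₀ : ℝ) {ε : ℝ} (hε : 0 < ε) :
    ∀ᶠ p : (ℝ × ℂ) × ℝ in (𝓝[>] 0 ×ˢ 𝓝 x) ×ˢ 𝓝 θ₀,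
      p.1.1 * (logGen p.1.2 (circlePt p.1.1 p.2)).re ≤
        ((p.1.1 : ℂ) / (p.1.1 - (p.2 - θ₀ : ℝ) * I) *
          L (orderOf (exp (θ₀ * I))) x ^ 2).re + ε := by
  have small := (tendsto_logGen hx θ₀).norm
  rw [norm_zero] at small
  filter_upwards [small.eventually_lt_const hε] with p hp
  have := (re_le_norm _).trans hp.le
  rw [sub_re, re_ofReal_mul] at this
  linarith

lemma re_ofReal_div_sub_mul_sq_le {σ : ℝ} (hσ : 0 < σ) (φ : ℝ) (a : ℂ) :
    ((σ : ℂ) / (σ - φ * I) * a ^ 2).re ≤ a.re ^ 2 := by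
  have hpos : 0 < σ ^ 2 + φ ^ 2 := by positivity
  have re_eq : ((σ : ℂ) / (σ - φ * I) * a ^ 2).re =
      (σ ^ 2 * (a.re ^ 2 - a.im ^ 2) - σ * φ * (2 * a.re * a.im)) / (σ ^ 2 + φ ^ 2) := by
    rw [div_mul_eq_mul_div, div_re]
    simp [normSq_apply, pow_two]
    field_simp
    ring
  rw [re_eq, div_le_iff₀ hpos]
  nlinarith [sq_nonneg (φ * a.re + σ * a.im)]

/-! ### The minor arcs -/

/-- The points of the open unit disk at which `f_k` exceeds every other `f_j` with `j ≥ 1`. -/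
def dominantSet (k : ℕ) : Set ℂ := {x | ‖x‖ < 1 ∧ ∀ j, 0 < j → j ≠ k → f j x < f k x}

lemma f_zero (x : ℂ) : f 0 x = 0 := by
  simp [f, L]

lemma f_pos_of_mem_dominantSet {k : ℕ} {x : ℂ} (hx : x ∈ dominantSet k) : 0 < f k x :=
  (f_nonneg (k + 1) x).trans_lt (hx.2 (k + 1) k.succ_pos k.succ_ne_self)

lemma pos_of_f_pos {k : ℕ} {x : ℂ} (hf : 0 < f k x) : 0 < k :=
  Nat.pos_of_ne_zero fun hk => by simp [hk, f_zero] at hf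

lemma pos_of_mem_dominantSet {k : ℕ} {x : ℂ} (hx : x ∈ dominantSet k) : 0 < k :=
  pos_of_f_pos (f_pos_of_mem_dominantSet hx)

lemma f_lt_of_mem_dominantSet {k : ℕ} {x : ℂ} (hx : x ∈ dominantSet k) {j : ℕ} (hj : j ≠ k) :
    f j x < f k x := by
  rcases j.eq_zero_or_pos with rfl | hj0
  · rw [f_zero]
    exact f_pos_of_mem_dominantSet hx
  · exact hx.2 j hj0 hj

lemma eq_zero_of_exp_pow_eq_one {h k : ℕ} (hk : 0 < k) {φ : ℝ} (hφ : |φ| ≤ π / k)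
    (hpow : exp ((2 * π * h / k + φ : ℝ) * I) ^ k = 1) : φ = 0 := by
  have hk0 : (k : ℂ) ≠ 0 := by exact_mod_cast hk.ne'
  have hkpos : (0 : ℝ) < k := by exact_mod_cast hk
  obtain ⟨n, hn⟩ : ∃ n : ℤ, (k : ℝ) * φ = 2 * π * n := by
    rw [← exp_nat_mul, exp_eq_one_iff] at hpow
    obtain ⟨n, hn⟩ := hpow
    refine ⟨n - h, ofReal_injective (mul_right_cancel₀ I_ne_zero ?_)⟩
    push_cast at hn ⊢
    field_simp at hn
    linear_combination I * hn
  have hle : |(k : ℝ) * φ| ≤ π := by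
    rwa [abs_mul, abs_of_pos hkpos, ← le_div_iff₀' hkpos]
  have hn0 : n = 0 := by
    rw [hn, abs_mul, abs_of_pos Real.two_pi_pos] at hle
    rw [← Int.abs_lt_one_iff, ← Int.cast_lt (R := ℝ), Int.cast_abs, Int.cast_one]
    nlinarith [Real.pi_pos]
  rw [hn0, Int.cast_zero, mul_zero] at hn
  exact (mul_eq_zero.1 hn).resolve_left hkpos.ne'

lemma eq_zero_and_coprime_of_orderOf_exp_eq {h k : ℕ} (hk : 0 < k) {φ : ℝ} (hφ : |φ| ≤ π / k)
    (ho : orderOf (exp ((2 * π * h / k + φ : ℝ) * I)) = k) : φ = 0 ∧ h.Coprime k := by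
  have hφ0 : φ = 0 := eq_zero_of_exp_pow_eq_one hk hφ (by
    simpa only [ho] using pow_orderOf_eq_one (exp ((2 * π * h / k + φ : ℝ) * I)))
  refine ⟨hφ0, ?_⟩
  rw [← (isPrimitiveRoot_exp k hk.ne').pow_iff_coprime hk h, ← exp_nat_mul]
  convert IsPrimitiveRoot.orderOf (exp ((2 * π * h / k + φ : ℝ) * I)) using 1
  · rw [hφ0]
    push_cast
    ring_nf
  · exact ho.symm

lemma exists_pole_le {k : ℕ} {x : ℂ} (hx : x ∈ dominantSet k) (h : ℕ) {M : ℝ} (hM : 0 < M)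
    (hML : ‖L k x‖ ^ 2 / M < f k x ^ 2) {φ₀ : ℝ} (hφ₀ : |φ₀| ≤ π / k) :
    ∃ b < f k x ^ 2, ∀ σ φ : ℝ, 0 < σ → (h.Coprime k → M * σ ≤ |φ|) →
      ((σ : ℂ) / (σ - (φ - φ₀ : ℝ) * I) *
        L (orderOf (exp ((2 * π * h / k + φ₀ : ℝ) * I))) x ^ 2).re ≤ b := by
  set j := orderOf (exp ((2 * π * h / k + φ₀ : ℝ) * I)) with hj
  by_cases hjk : j = k
  · obtain ⟨rfl, hcop⟩ :=
      eq_zero_and_coprime_of_orderOf_exp_eq (pos_of_mem_dominantSet hx) hφ₀ hjk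
    refine ⟨_, hML, fun σ φ hσ hφ => (re_le_norm _).trans ?_⟩
    rw [hjk, sub_zero, norm_mul, norm_pow, mul_comm, div_eq_mul_inv (‖L k x‖ ^ 2)]
    gcongr
    exact norm_ofReal_div_sub_le_inv hσ hM (hφ hcop)
  · exact ⟨f j x ^ 2,
      pow_lt_pow_left₀ (f_lt_of_mem_dominantSet hx hjk) (f_nonneg _ _) two_ne_zero,
      fun σ φ hσ _ => re_ofReal_div_sub_mul_sq_le hσ _ _⟩

lemma exists_lt_eventually_forall_mem_le {α β : Type*} [TopologicalSpace β] {K : Set β}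
    (hK : IsCompact K) {l : Filter α} {a : ℝ} {P : α → β → Prop} {g : α → β → ℝ}
    (hloc : ∀ b ∈ K, ∃ c < a, ∀ᶠ p in l ×ˢ 𝓝 b, P p.1 p.2 → g p.1 p.2 ≤ c) :
    ∃ c < a, ∀ᶠ p in l, ∀ b ∈ K, P p b → g p b ≤ c := by
  refine hK.induction_on (p := fun s => ∃ c < a, ∀ᶠ p in l, ∀ b ∈ s, P p b → g p b ≤ c)
    ⟨a - 1, by simp⟩ ?_ ?_ fun b hb => ?_
  · rintro s t hst ⟨c, hc, hev⟩
    exact ⟨c, hc, hev.mono fun p hp b hb => hp b (hst hb)⟩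
  · rintro s t ⟨c, hc, hev⟩ ⟨c', hc', hev'⟩
    refine ⟨max c c', max_lt hc hc', ?_⟩
    filter_upwards [hev, hev'] with p hp hp' b hb hPb
    exact hb.elim (fun hb => (hp b hb hPb).trans (le_max_left _ _))
      fun hb => (hp' b hb hPb).trans (le_max_right _ _)
  · obtain ⟨c, hc, hev⟩ := hloc b hb
    obtain ⟨P', hP', Q, hQ, hPQ⟩ := eventually_prod_iff.1 hev
    exact ⟨{b | Q b}, mem_nhdsWithin_of_mem_nhds hQ, c, hc,
      hP'.mono fun p hp b hb => hPQ hp hb⟩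

theorem exists_minor_arc_bound {k : ℕ} {x : ℂ} (hx : x ∈ dominantSet k) (h : ℕ) {M : ℝ}
    (hM : 0 < M) (hML : ‖L k x‖ ^ 2 / M < f k x ^ 2) :
    ∃ c < f k x ^ 2, ∀ᶠ p : ℝ × ℂ in 𝓝[>] 0 ×ˢ 𝓝 x,
      ∀ φ ∈ Set.Icc (-(π / k)) (π / k), (h.Coprime k → M * p.1 ≤ |φ|) →
        p.1 * (logGen p.2 (circlePt p.1 (2 * π * h / k + φ))).re ≤ c := by
  refine exists_lt_eventually_forall_mem_le (P := fun (p : ℝ × ℂ) φ => h.Coprime k → M * p.1 ≤ |φ|)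
    (g := fun p φ => p.1 * (logGen p.2 (circlePt p.1 (2 * π * h / k + φ))).re)
    isCompact_Icc fun φ₀ hφ₀ => ?_
  obtain ⟨b, hb, pole_le⟩ := exists_pole_le hx h hM hML (abs_le.2 hφ₀)
  obtain ⟨c, hbc, hc⟩ := exists_between hb
  have tendsto_angle : Tendsto (fun p : (ℝ × ℂ) × ℝ => (p.1, 2 * π * h / k + p.2))
      ((𝓝[>] 0 ×ˢ 𝓝 x) ×ˢ 𝓝 φ₀) ((𝓝[>] 0 ×ˢ 𝓝 x) ×ˢ 𝓝 (2 * π * h / k + φ₀)) :=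
    tendsto_fst.prodMk (tendsto_snd.const_add _)
  refine ⟨c, hc, ?_⟩
  filter_upwards [tendsto_angle.eventually (eventually_mul_re_logGen_le hx.1 _ (sub_pos.2 hbc)),
    (tendsto_fst.comp tendsto_fst).eventually self_mem_nhdsWithin] with p hp hσ hcop
  have := pole_le p.1.1 p.2 hσ hcop
  rw [add_sub_add_left_eq_sub] at hp
  linarith

/-! ### The saddle points -/

lemma mem_slitPlane_of_f_pos {k : ℕ} {x : ℂ} (hf : 0 < f k x) : Li2 (x ^ k) ∈ slitPlane := by
  by_contra hslit
  obtain ⟨re_nonpos, im_eq_zero⟩ : (Li2 (x ^ k)).re ≤ 0 ∧ (Li2 (x ^ k)).im = 0 := by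
    simpa [mem_slitPlane_iff] using hslit
  have norm_eq : ‖Li2 (x ^ k)‖ = -(Li2 (x ^ k)).re := by
    rw [← abs_re_eq_norm.2 im_eq_zero, abs_of_nonpos re_nonpos]
  have f_sq_eq : f k x ^ 2 = 0 := by
    rw [f_sq, sq_re_csqrt, norm_eq]
    simp
  exact hf.ne' (pow_eq_zero_iff two_ne_zero |>.1 f_sq_eq)

lemma continuousAt_csqrt {z : ℂ} (hz : z ∈ slitPlane) : ContinuousAt csqrt z :=
  continuousAt_id.cpow continuousAt_const hz

lemma continuousAt_L {k : ℕ} {x : ℂ} (hx : ‖x‖ < 1) (hf : 0 < f k x) :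
    ContinuousAt (L k) x := by
  have norm_pow_lt : ‖x ^ k‖ < 1 := by
    rw [norm_pow]
    exact pow_lt_one₀ (norm_nonneg x) hx (pos_of_f_pos hf).ne'
  have continuousAt_Li2 : ContinuousAt (fun y => Li2 (y ^ k)) x :=
    ContinuousAt.comp (g := Li2) (hasDerivAt_Li2 norm_pow_lt).continuousAt (by fun_prop)
  exact (ContinuousAt.comp (g := csqrt) (f := fun y => Li2 (y ^ k))
    (continuousAt_csqrt (mem_slitPlane_of_f_pos hf)) continuousAt_Li2).div_const _

lemma continuousAt_f {k : ℕ} {x : ℂ} (hx : ‖x‖ < 1) (hf : 0 < f k x) : ContinuousAt (f k) x :=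
  continuous_re.continuousAt.comp (continuousAt_L hx hf)

/-- The points of the vertical line through `L_k(y)`, which is the saddle point of
`L_k(y)² / τ + b⁴ τ` in the variable `b² τ`. The real parameter `t` is scaled so that the integrand
varies on the scale `t ≍ 1`. -/
def saddlePt (k : ℕ) (b : ℝ) (y : ℂ) (t : ℝ) : ℂ := L k y - t / b * I

/-- The angle `φ` for which `τ = f_k(y) / b² - i φ` is `saddlePt k b y t / b²`. -/
def saddleAngle (k : ℕ) (b : ℝ) (y : ℂ) (t : ℝ) : ℝ := t / b ^ 3 - (L k y).im / b ^ 2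

lemma saddlePt_re (k : ℕ) (b : ℝ) (y : ℂ) (t : ℝ) : (saddlePt k b y t).re = f k y := by
  simp [saddlePt, f, ← ofReal_div]

lemma saddlePt_im (k : ℕ) (b : ℝ) (y : ℂ) (t : ℝ) :
    (saddlePt k b y t).im = (L k y).im - t / b := by
  simp [saddlePt, ← ofReal_div]

lemma saddleAngle_eq {b : ℝ} (hb : b ≠ 0) (k : ℕ) (y : ℂ) (t : ℝ) :
    saddleAngle k b y t = -(saddlePt k b y t).im / b ^ 2 := by
  rw [saddlePt_im, saddleAngle]
  field_simp
  ring

lemma ofReal_sub_saddleAngle_mul_I {b : ℝ} (hb : b ≠ 0) (k : ℕ) (y : ℂ) (t : ℝ) :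
    ((f k y / b ^ 2 : ℝ) : ℂ) - saddleAngle k b y t * I = saddlePt k b y t / b ^ 2 := by
  rw [saddleAngle_eq hb, ← saddlePt_re k b y t]
  conv_rhs => rw [← re_add_im (saddlePt k b y t)]
  push_cast
  ring

/-- The exponent of the integrand near the saddle point, relative to its value there. -/
def saddleExponent (h k : ℕ) (b : ℝ) (y : ℂ) (t : ℝ) : ℂ :=
  logGen y (circlePt (f k y / b ^ 2) (2 * π * h / k + saddleAngle k b y t)) - w h k y +
    b ^ 2 * (saddlePt k b y t - 2 * L k y)

lemma continuous_saddleExponent (h : ℕ) {k : ℕ} {b : ℝ} (hb : 0 < b) {y : ℂ} (hy : ‖y‖ < 1)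
    (hf : 0 < f k y) : Continuous (saddleExponent h k b y) := by
  unfold saddleExponent saddlePt saddleAngle
  have continuous_comp := (continuous_logGen_circlePt hy (σ := f k y / b ^ 2) (by positivity)).comp
    (show Continuous fun t : ℝ => 2 * π * h / k + (t / b ^ 3 - (L k y).im / b ^ 2) by fun_prop)
  simp only [Function.comp_def] at continuous_comp
  fun_prop

lemma saddleExponent_add_sq_div {b : ℝ} (hb : b ≠ 0) (h : ℕ) {k : ℕ} {y : ℂ} (hf : 0 < f k y)
    (t : ℝ) :
    saddleExponent h k b y t + t ^ 2 / saddlePt k b y t =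
      logGen y (circlePt (f k y / b ^ 2) (2 * π * h / k + saddleAngle k b y t)) -
        (L k y ^ 2 / (saddlePt k b y t / b ^ 2) + w h k y) := by
  have hb' : (b : ℂ) ≠ 0 := ofReal_ne_zero.2 hb
  have saddlePt_ne_zero : saddlePt k b y t ≠ 0 := ne_zero_of_re_pos (by rwa [saddlePt_re])
  have L_eq : L k y = saddlePt k b y t + t / b * I := by
    rw [saddlePt]
    ring
  rw [saddleExponent, L_eq]
  field_simp
  linear_combination (t : ℂ) ^ 2 * I_sq

lemma exists_saddleExponent_bound {h k : ℕ} (hk : 0 < k) (hc : h.Coprime k) {M r : ℝ}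
    (hM : 0 ≤ M) (hr0 : 0 ≤ r) (hr : r < 1) :
    ∃ C, 0 ≤ C ∧ ∀ y : ℂ, ‖y‖ ≤ r → ∀ b t : ℝ, 0 < b → saddlePt k b y t ∈ sector M →
      ‖saddleExponent h k b y t + t ^ 2 / saddlePt k b y t‖ ≤
        C * ‖saddlePt k b y t‖ / b ^ 2 := by
  obtain ⟨C, hC⟩ := exists_logGen_expansion hk hc hM hr0 hr
  refine ⟨max C 0, le_max_right _ _, fun y hy b t hb hmem => ?_⟩
  have hf : 0 < f k y := saddlePt_re k b y t ▸ hmem.1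
  have angle_le : |saddleAngle k b y t| ≤ M * (f k y / b ^ 2) := by
    rw [saddleAngle_eq hb.ne', abs_div, abs_neg, abs_of_pos (pow_pos hb 2), mul_div_assoc',
      ← saddlePt_re k b y t]
    exact div_le_div_of_nonneg_right hmem.2 (by positivity)
  have expansion := hC y hy _ _ (by positivity) angle_le
  rw [ofReal_sub_saddleAngle_mul_I hb.ne', ← saddleExponent_add_sq_div hb.ne' h hf, norm_div,
    norm_pow, norm_real, Real.norm_of_nonneg hb.le, ← mul_div_assoc] at expansion
  refine expansion.trans ?_
  gcongr
  exact le_max_left _ _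

lemma sq_div_le_re_sq_div {M : ℝ} {u : ℂ} (hu : u ∈ sector M) (t : ℝ) :
    t ^ 2 / ((1 + M) ^ 2 * u.re) ≤ ((t : ℂ) ^ 2 / u).re := by
  have re_pos : 0 < u.re := hu.1
  have norm_pos : 0 < ‖u‖ := norm_pos_iff.2 (ne_zero_of_re_pos re_pos)
  have re_eq : ((t : ℂ) ^ 2 / u).re = t ^ 2 * u.re / ‖u‖ ^ 2 := by
    rw [div_eq_mul_inv, ← ofReal_pow, re_ofReal_mul, inv_re, normSq_eq_norm_sq, mul_div_assoc]
  calc t ^ 2 / ((1 + M) ^ 2 * u.re) = t ^ 2 * u.re / ((1 + M) * u.re) ^ 2 := by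
        field_simp
    _ ≤ t ^ 2 * u.re / ‖u‖ ^ 2 := by
        gcongr
        exact norm_le_of_mem_sector hu
    _ = ((t : ℂ) ^ 2 / u).re := re_eq.symm

lemma exists_norm_exp_saddleExponent_le {h k : ℕ} (hk : 0 < k) (hc : h.Coprime k) {M r : ℝ}
    (hM : 0 ≤ M) (hr0 : 0 ≤ r) (hr : r < 1) :
    ∃ C, 0 ≤ C ∧ ∀ y : ℂ, ‖y‖ ≤ r → ∀ b t : ℝ, 1 ≤ b → saddlePt k b y t ∈ sector M →
      ‖exp (saddleExponent h k b y t)‖ ≤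
        Real.exp (C * f k y - t ^ 2 / ((1 + M) ^ 2 * f k y)) := by
  obtain ⟨C, hC0, hC⟩ := exists_saddleExponent_bound hk hc hM hr0 hr
  refine ⟨C * (1 + M), by positivity, fun y hy b t hb hmem => ?_⟩
  rw [norm_exp, Real.exp_le_exp, ← saddlePt_re k b y t]
  have re_le : (saddleExponent h k b y t + t ^ 2 / saddlePt k b y t).re ≤
      C * (1 + M) * (saddlePt k b y t).re :=
    calc _ ≤ C * ‖saddlePt k b y t‖ / b ^ 2 :=
          (re_le_norm _).trans (hC y hy b t (by linarith) hmem)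
      _ ≤ C * ‖saddlePt k b y t‖ := div_le_self (by positivity) (one_le_pow₀ hb)
      _ ≤ C * ((1 + M) * (saddlePt k b y t).re) := by
          gcongr
          exact norm_le_of_mem_sector hmem
      _ = _ := (mul_assoc _ _ _).symm
  rw [add_re] at re_le
  linarith [sq_div_le_re_sq_div hmem t]

/-- The range of the parameter `t` in which `saddlePt k b y t` lies in `sector M`. -/
def saddleWindow (k : ℕ) (M b : ℝ) (y : ℂ) : Set ℝ :=
  Set.Ioc (b * ((L k y).im - M * f k y)) (b * ((L k y).im + M * f k y))

lemma saddlePt_mem_sector {k : ℕ} {M b : ℝ} (hb : 0 < b) {y : ℂ} (hf : 0 < f k y) {t : ℝ}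
    (ht : t ∈ saddleWindow k M b y) : saddlePt k b y t ∈ sector M := by
  refine ⟨by rwa [saddlePt_re], ?_⟩
  have lower := (lt_div_iff₀' hb).2 ht.1
  have upper := (div_le_iff₀' hb).2 ht.2
  rw [saddlePt_re, saddlePt_im, abs_le]
  constructor <;> linarith

section Limits

variable {k : ℕ} {x : ℂ}

lemma tendsto_saddlePt (hx : ‖x‖ < 1) (hf : 0 < f k x) (t : ℝ) :
    Tendsto (fun p : ℝ × ℂ => saddlePt k p.1 p.2 t) (atTop ×ˢ 𝓝 x) (𝓝 (L k x)) := by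
  have tendsto_div : Tendsto (fun p : ℝ × ℂ => ((t / p.1 : ℝ) : ℂ)) (atTop ×ˢ 𝓝 x) (𝓝 0) := by
    simpa only [ofReal_zero] using (tendsto_fst.const_div_atTop t).ofReal
  simpa [saddlePt] using
    ((continuousAt_L hx hf).tendsto.comp tendsto_snd).sub (tendsto_div.mul_const I)

lemma eventually_mem_saddleWindow (hx : ‖x‖ < 1) (hf : 0 < f k x) {M : ℝ}
    (hM : |(L k x).im| < M * f k x) (t : ℝ) :
    ∀ᶠ p : ℝ × ℂ in atTop ×ˢ 𝓝 x, t ∈ saddleWindow k M p.1 p.2 := by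
  have tendsto_im := (continuous_im.tendsto _).comp (tendsto_saddlePt hx hf t)
  have tendsto_bound := (((continuousAt_f hx hf).tendsto.comp tendsto_snd).const_mul M :
    Tendsto (fun p : ℝ × ℂ => M * f k p.2) (atTop ×ˢ 𝓝 x) _)
  filter_upwards [tendsto_im.abs.eventually_lt tendsto_bound hM,
    tendsto_fst.eventually (eventually_gt_atTop 0)] with p hp hb
  simp only [Function.comp_apply, saddlePt_im, abs_lt] at hp
  rw [saddleWindow, Set.mem_Ioc, ← lt_div_iff₀' hb, ← div_le_iff₀' hb]
  constructor <;> linarith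

lemma eventually_norm_lt_and_f_pos (hx : ‖x‖ < 1) (hf : 0 < f k x) {r : ℝ} (hr : ‖x‖ < r) :
    ∀ᶠ p : ℝ × ℂ in atTop ×ˢ 𝓝 x, ‖p.2‖ < r ∧ 0 < f k p.2 :=
  (tendsto_snd.norm.eventually_lt_const hr).and
    (((continuousAt_f hx hf).tendsto.comp tendsto_snd).eventually_const_lt hf)

lemma tendsto_saddleExponent {h : ℕ} (hc : h.Coprime k) (hx : ‖x‖ < 1) (hf : 0 < f k x)
    (t : ℝ) :
    Tendsto (fun p : ℝ × ℂ => saddleExponent h k p.1 p.2 t) (atTop ×ˢ 𝓝 x)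
      (𝓝 (-(t ^ 2 / L k x))) := by
  obtain ⟨r, hxr, hr⟩ := exists_between hx
  obtain ⟨M, hM⟩ := exists_gt (|(L k x).im| / f k x)
  rw [div_lt_iff₀ hf] at hM
  have hM0 : 0 < M := (pos_iff_pos_of_mul_pos ((abs_nonneg _).trans_lt hM)).2 hf
  obtain ⟨C, -, hC⟩ :=
    exists_saddleExponent_bound (pos_of_f_pos hf) hc hM0.le ((norm_nonneg x).trans hxr.le) hr
  have tendsto_pt := tendsto_saddlePt hx hf t
  have tendsto_remainder : Tendsto (fun p : ℝ × ℂ =>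
      saddleExponent h k p.1 p.2 t + t ^ 2 / saddlePt k p.1 p.2 t) (atTop ×ˢ 𝓝 x) (𝓝 0) := by
    refine squeeze_zero_norm' ?_ ((tendsto_pt.norm.const_mul C).div_atTop
      ((tendsto_pow_atTop two_ne_zero).comp tendsto_fst))
    filter_upwards [eventually_norm_lt_and_f_pos hx hf hxr, eventually_mem_saddleWindow hx hf hM t,
      tendsto_fst.eventually (eventually_gt_atTop 0)] with p ⟨hy, hfy⟩ ht hb
    exact hC p.2 hy.le p.1 t hb (saddlePt_mem_sector hb hfy ht)
  have := tendsto_remainder.sub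
    ((tendsto_const_nhds (x := (t : ℂ) ^ 2)).div tendsto_pt (ne_zero_of_re_pos hf))
  rw [zero_sub] at this
  exact this.congr fun p => add_sub_cancel_right _ _

lemma csqrt_ofReal_mul {r : ℝ} (hr : 0 ≤ r) (z : ℂ) : csqrt (r * z) = √r * csqrt z := by
  have csqrt_ofReal : ((√r : ℝ) : ℂ) = csqrt r := by
    rw [csqrt, Real.sqrt_eq_rpow, ofReal_cpow hr]
    norm_num
  rw [csqrt_ofReal, csqrt, csqrt, csqrt]
  rcases hr.eq_or_lt with rfl | hr
  · simp
  · rcases eq_or_ne z 0 with rfl | hz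
    · simp
    · have hr' : (r : ℂ) ≠ 0 := ofReal_ne_zero.2 hr.ne'
      rw [cpow_def_of_ne_zero (mul_ne_zero hr' hz), cpow_def_of_ne_zero hr',
        cpow_def_of_ne_zero hz, log_ofReal_mul hr hz, ofReal_log hr.le, add_mul, exp_add]

lemma integral_exp_neg_sq_div {a : ℂ} (ha : 0 < a.re) :
    ∫ t : ℝ, exp (-(t ^ 2 / a)) = √π * csqrt a := by
  have ha0 : a ≠ 0 := ne_zero_of_re_pos ha
  have inv_re_pos : 0 < (1 / a).re := by
    rw [one_div, inv_re]
    exact div_pos ha (normSq_pos.2 ha0)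
  calc ∫ t : ℝ, exp (-(t ^ 2 / a)) = ∫ t : ℝ, exp (-(1 / a) * t ^ 2) := by
        congr with t
        ring_nf
    _ = csqrt (π * a) := by
        rw [integral_gaussian_complex inv_re_pos, div_div_eq_mul_div, div_one, csqrt]
    _ = √π * csqrt a := csqrt_ofReal_mul Real.pi_pos.le a

theorem tendsto_integral_saddleWindow {h : ℕ} (hc : h.Coprime k) (hx : ‖x‖ < 1)
    (hf : 0 < f k x) {M : ℝ} (hM : |(L k x).im| < M * f k x) :
    Tendsto (fun p : ℝ × ℂ => ∫ t : ℝ, (saddleWindow k M p.1 p.2).indicator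
        (fun t => exp (saddleExponent h k p.1 p.2 t)) t)
      (atTop ×ˢ 𝓝 x) (𝓝 (√π * csqrt (L k x))) := by
  obtain ⟨r, hxr, hr⟩ := exists_between hx
  have hM0 : 0 < M := (pos_iff_pos_of_mul_pos ((abs_nonneg _).trans_lt hM)).2 hf
  obtain ⟨C, hC0, hC⟩ :=
    exists_norm_exp_saddleExponent_le (pos_of_f_pos hf) hc hM0.le ((norm_nonneg x).trans hxr.le) hr
  set l : Filter (ℝ × ℂ) := atTop ×ˢ 𝓝 x
  have near := eventually_norm_lt_and_f_pos hx hf hxr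
  have one_le : ∀ᶠ p : ℝ × ℂ in l, 1 ≤ p.1 := tendsto_fst.eventually (eventually_ge_atTop 1)
  have f_lt : ∀ᶠ p : ℝ × ℂ in l, f k p.2 < 2 * f k x :=
    ((continuousAt_f hx hf).tendsto.comp tendsto_snd).eventually_lt_const (by linarith)
  set c : ℝ := 1 / ((1 + M) ^ 2 * (2 * f k x)) with hcdef
  have hc0 : 0 < c := by positivity
  rw [← integral_exp_neg_sq_div hf]
  refine MeasureTheory.tendsto_integral_filter_of_dominated_convergence
    (fun t : ℝ => Real.exp (C * (2 * f k x)) * Real.exp (-c * t ^ 2)) ?_ ?_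
    ((integrable_exp_neg_mul_sq hc0).const_mul _) (.of_forall fun t => ?_)
  · filter_upwards [near, one_le] with p ⟨hy, hfy⟩ hb
    exact (continuous_saddleExponent h (by linarith) (hy.trans hr) hfy).cexp
      |>.aestronglyMeasurable.indicator measurableSet_Ioc
  · filter_upwards [near, one_le, f_lt] with p ⟨hy, hfy⟩ hb hlt
    refine .of_forall fun t => ?_
    by_cases ht : t ∈ saddleWindow k M p.1 p.2
    · rw [Set.indicator_of_mem ht, ← Real.exp_add]
      refine (hC p.2 hy.le p.1 t hb (saddlePt_mem_sector (by linarith) hfy ht)).trans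
        (Real.exp_le_exp.2 ?_)
      have gaussian_le : c * t ^ 2 ≤ t ^ 2 / ((1 + M) ^ 2 * f k p.2) := by
        rw [hcdef, one_div_mul_eq_div]
        gcongr
      have const_le : C * f k p.2 ≤ C * (2 * f k x) := by gcongr
      linarith
    · rw [Set.indicator_of_notMem ht, norm_zero]
      positivity
  · refine (tendsto_saddleExponent hc hx hf t).cexp.congr' ?_
    filter_upwards [eventually_mem_saddleWindow hx hf hM t] with p hp
    rw [Set.indicator_of_mem hp]

end Limits

/-! ### The arcs around the roots of unity -/

/-- With `b = n^{1/4}`, the integrand of Cauchy's formula for `F n` on the circle through the saddle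
points, at the angle `φ` from `e^{2πih/k}`; the remaining estimates hold for all real `b`. -/
def arcIntegrand (h k : ℕ) (b : ℝ) (y : ℂ) (φ : ℝ) : ℂ :=
  exp (logGen y (circlePt (f k y / b ^ 2) (2 * π * h / k + φ))) *
    exp (b ^ 4 * ((f k y / b ^ 2 : ℝ) - (2 * π * h / k + φ : ℝ) * I))

/-- The integral over the arc centred at `e^{2πih/k}`. -/
def arcIntegral (h k : ℕ) (b : ℝ) (y : ℂ) : ℂ :=
  ∫ φ in -(π / k)..π / k, arcIntegrand h k b y φ

/-- The growth factor `b^{-3} e^{2 b² L_k(y)}` of `mainTerm`, with `b = n^{1/4}`. -/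
def growth (k : ℕ) (b : ℝ) (y : ℂ) : ℂ := exp (2 * b ^ 2 * L k y) / b ^ 3

/-- The coefficient that `e^{2πih/k}` contributes to the main term; it vanishes unless `h / k` is
in lowest terms. -/
def rootCoeff (h k : ℕ) (s : ℝ) (y : ℂ) : ℂ :=
  if h.Coprime k then exp (-2 * π * I * s * h / k) * exp (w h k y) else 0

lemma norm_growth {b : ℝ} (hb : 0 < b) (k : ℕ) (y : ℂ) :
    ‖growth k b y‖ = Real.exp (2 * b ^ 2 * f k y) / b ^ 3 := by
  have re_eq : (2 * (b : ℂ) ^ 2 * L k y).re = 2 * b ^ 2 * f k y := by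
    rw [f, ← re_ofReal_mul]
    push_cast
    rfl
  rw [growth, norm_div, norm_pow, norm_real, Real.norm_of_nonneg hb.le, norm_exp, re_eq]

lemma growth_ne_zero {b : ℝ} (hb : 0 < b) (k : ℕ) (y : ℂ) : growth k b y ≠ 0 :=
  div_ne_zero (exp_ne_zero _) (pow_ne_zero 3 (ofReal_ne_zero.2 hb.ne'))

lemma continuous_arcIntegrand (h : ℕ) {k : ℕ} {b : ℝ} (hb : 0 < b) {y : ℂ} (hy : ‖y‖ < 1)
    (hf : 0 < f k y) : Continuous (arcIntegrand h k b y) := by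
  unfold arcIntegrand
  have continuous_comp := (continuous_logGen_circlePt hy (σ := f k y / b ^ 2) (by positivity)).comp
    (show Continuous fun φ : ℝ => 2 * π * h / k + φ by fun_prop)
  simp only [Function.comp_def] at continuous_comp
  fun_prop

lemma sum_integral_arcs {k : ℕ} (hk : 0 < k) {g : ℝ → ℂ} (hg : Continuous g) :
    ∑ h ∈ Finset.range k, ∫ φ in -(π / k)..π / k, g (2 * π * h / k + φ) =
      ∫ θ in -(π / k)..-(π / k) + 2 * π, g θ := by
  have hk' : (k : ℝ) ≠ 0 := by exact_mod_cast hk.ne'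
  have adjacent := intervalIntegral.sum_integral_adjacent_intervals (f := g)
    (μ := MeasureTheory.volume) (a := fun i : ℕ => 2 * π * i / k - π / k) (n := k)
    fun i _ => hg.intervalIntegrable _ _
  convert adjacent using 1
  · refine Finset.sum_congr rfl fun h _ => ?_
    rw [intervalIntegral.integral_comp_add_left]
    congr 1
    push_cast
    field_simp
    ring
  · congr 1
    · simp
    · field_simp
      ring

lemma sum_arcIntegral {k n : ℕ} (hn : 1 ≤ n) {b : ℝ} (hb : 0 < b) (hbn : b ^ 4 = n) {y : ℂ}
    (hy : ‖y‖ < 1) (hf : 0 < f k y) :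
    ∑ h ∈ Finset.range k, arcIntegral h k b y = 2 * π * (F n).eval y := by
  have hσ : 0 < f k y / b ^ 2 := by positivity
  have hbn' : (b : ℂ) ^ 4 = n := by exact_mod_cast hbn
  have integrand_continuous : Continuous fun θ : ℝ => exp (logGen y (circlePt (f k y / b ^ 2) θ)) *
      exp (n * ((f k y / b ^ 2 : ℝ) - θ * I)) := by
    have := continuous_logGen_circlePt hy hσ
    fun_prop
  rw [← integral_exp_logGen hy hσ (-(π / k)) hn,
    ← sum_integral_arcs (pos_of_f_pos hf) integrand_continuous, ← hbn']
  rfl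

lemma arcIntegrand_saddleAngle {b : ℝ} (hb : b ≠ 0) (h k : ℕ) (y : ℂ) (t : ℝ) :
    arcIntegrand h k b y (saddleAngle k b y t) =
      exp (-2 * π * I * (b ^ 4 : ℝ) * h / k) * exp (w h k y) * exp (2 * b ^ 2 * L k y) *
        exp (saddleExponent h k b y t) := by
  have : (b : ℂ) ≠ 0 := ofReal_ne_zero.2 hb
  have cauchy_exponent : (b : ℂ) ^ 4 * ((f k y / b ^ 2 : ℝ) -
      (2 * π * h / k + saddleAngle k b y t : ℝ) * I) =
        -2 * π * I * (b ^ 4 : ℝ) * h / k + b ^ 2 * saddlePt k b y t :=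
    calc _ = -2 * π * I * (b ^ 4 : ℝ) * h / k +
          b ^ 4 * ((f k y / b ^ 2 : ℝ) - saddleAngle k b y t * I) := by
          push_cast
          ring
      _ = _ := by
          rw [ofReal_sub_saddleAngle_mul_I hb]
          field_simp
  rw [arcIntegrand, cauchy_exponent, saddleExponent, ← exp_add, ← exp_add, ← exp_add, ← exp_add]
  ring_nf

lemma integral_arcIntegrand_saddleWindow {h k : ℕ} (hc : h.Coprime k) {b : ℝ} (hb : 0 < b) {y : ℂ}
    {M : ℝ} (hM : 0 ≤ M * f k y) :
    ∫ φ in -(M * f k y / b ^ 2)..M * f k y / b ^ 2, arcIntegrand h k b y φ =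
      growth k b y * (rootCoeff h k (b ^ 4) y *
        ∫ t : ℝ, (saddleWindow k M b y).indicator
          (fun t => exp (saddleExponent h k b y t)) t) := by
  have substitution := intervalIntegral.inv_smul_integral_comp_div_sub
    (a := b * ((L k y).im - M * f k y)) (b := b * ((L k y).im + M * f k y))
    (arcIntegrand h k b y) (b ^ 3) ((L k y).im / b ^ 2)
  have lower : b * ((L k y).im - M * f k y) / b ^ 3 - (L k y).im / b ^ 2 =
      -(M * f k y / b ^ 2) := by
    field_simp
    ring
  have upper : b * ((L k y).im + M * f k y) / b ^ 3 - (L k y).im / b ^ 2 =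
      M * f k y / b ^ 2 := by
    field_simp
    ring
  have integrand (t : ℝ) := arcIntegrand_saddleAngle hb.ne' h k y t
  simp only [saddleAngle] at integrand
  simp_rw [lower, upper, integrand, intervalIntegral.integral_const_mul] at substitution
  rw [← substitution, saddleWindow, MeasureTheory.integral_indicator measurableSet_Ioc,
    ← intervalIntegral.integral_of_le (by gcongr; linarith), rootCoeff, if_pos hc, growth,
    real_smul]
  push_cast
  ring

lemma exists_pos_gt_im_and_norm_sq_div_lt {a : ℂ} (ha : 0 < a.re) :
    ∃ M, 0 < M ∧ |a.im| < M * a.re ∧ ‖a‖ ^ 2 / M < a.re ^ 2 := by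
  have norm_small : ∀ᶠ M : ℝ in atTop, ‖a‖ ^ 2 / M < a.re ^ 2 :=
    (tendsto_id.const_div_atTop (‖a‖ ^ 2)).eventually_lt_const (by positivity)
  have im_small : ∀ᶠ M : ℝ in atTop, |a.im| < M * a.re :=
    (tendsto_id.atTop_mul_const ha).eventually_gt_atTop _
  exact ((eventually_gt_atTop 0).and (im_small.and norm_small)).exists

lemma tendsto_pow_three_mul_exp_neg {δ : ℝ} (hδ : 0 < δ) :
    Tendsto (fun b : ℝ => b ^ 3 * Real.exp (-δ * b ^ 2)) atTop (𝓝 0) := by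
  have tendsto_exp : Tendsto (fun b : ℝ => Real.exp (-(1 / 2) * b)) atTop (𝓝 0) :=
    Real.tendsto_exp_atBot.comp (tendsto_id.const_mul_atTop_of_neg (by norm_num))
  exact_mod_cast (rpow_mul_exp_neg_mul_sq_isLittleO_exp_neg hδ 3).isBigO.trans_tendsto tendsto_exp

lemma norm_arcIntegrand {b : ℝ} (hb : b ≠ 0) (h k : ℕ) (y : ℂ) (φ : ℝ) :
    ‖arcIntegrand h k b y φ‖ = Real.exp
      ((logGen y (circlePt (f k y / b ^ 2) (2 * π * h / k + φ))).re + b ^ 2 * f k y) := by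
  have re_eq : ((b : ℂ) ^ 4 * ((f k y / b ^ 2 : ℝ) - (2 * π * h / k + φ : ℝ) * I)).re =
      b ^ 2 * f k y := by
    rw [← ofReal_pow, re_ofReal_mul, sub_re, ofReal_re, re_ofReal_mul, I_re, mul_zero, sub_zero]
    field_simp
  rw [arcIntegrand, ← exp_add, norm_exp, add_re, re_eq]

lemma tendsto_f_div_sq {k : ℕ} {x : ℂ} (hx : ‖x‖ < 1) (hf : 0 < f k x) :
    Tendsto (fun p : ℝ × ℂ => (f k p.2 / p.1 ^ 2, p.2)) (atTop ×ˢ 𝓝 x) (𝓝[>] 0 ×ˢ 𝓝 x) := by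
  have tendsto_f : Tendsto (fun p : ℝ × ℂ => f k p.2) (atTop ×ˢ 𝓝 x) (𝓝 (f k x)) :=
    (continuousAt_f hx hf).tendsto.comp tendsto_snd
  refine .prodMk (tendsto_nhdsWithin_iff.2 ⟨tendsto_f.div_atTop
    ((tendsto_pow_atTop two_ne_zero).comp tendsto_fst), ?_⟩) tendsto_snd
  filter_upwards [tendsto_f.eventually_const_lt hf, tendsto_fst.eventually (eventually_gt_atTop 0)]
    with p hfy hb
  exact div_pos hfy (pow_pos hb 2)

lemma exists_norm_arcIntegrand_le {k : ℕ} {x : ℂ} (hx : x ∈ dominantSet k) (h : ℕ) {M : ℝ}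
    (hM : 0 < M) (hML : ‖L k x‖ ^ 2 / M < f k x ^ 2) :
    ∃ d : ℝ → ℝ, Tendsto d atTop (𝓝 0) ∧ ∀ᶠ p : ℝ × ℂ in atTop ×ˢ 𝓝 x,
      ∀ φ ∈ Set.Icc (-(π / k)) (π / k), (h.Coprime k → M * (f k p.2 / p.1 ^ 2) ≤ |φ|) →
        ‖arcIntegrand h k p.1 p.2 φ‖ ≤ d p.1 * ‖growth k p.1 p.2‖ := by
  have hf : 0 < f k x := f_pos_of_mem_dominantSet hx
  obtain ⟨c, hc, minor⟩ := exists_minor_arc_bound hx h hM hML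
  have tendsto_f := (continuousAt_f hx.1 hf).tendsto.comp (tendsto_snd (f := (atTop : Filter ℝ)))
  have tendsto_gap : Tendsto (fun p : ℝ × ℂ => f k p.2 - c / f k p.2) (atTop ×ˢ 𝓝 x)
      (𝓝 (f k x - c / f k x)) := tendsto_f.sub (tendsto_const_nhds.div tendsto_f hf.ne')
  have gap_pos : 0 < f k x - c / f k x := by
    rwa [sub_pos, div_lt_iff₀ hf, ← pow_two]
  obtain ⟨δ, hδ, hδ_lt⟩ := exists_between gap_pos
  refine ⟨fun b => b ^ 3 * Real.exp (-δ * b ^ 2), tendsto_pow_three_mul_exp_neg hδ, ?_⟩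
  filter_upwards [(tendsto_f_div_sq hx.1 hf).eventually minor,
    tendsto_gap.eventually_const_lt hδ_lt, eventually_norm_lt_and_f_pos hx.1 hf hx.1,
    tendsto_fst.eventually (eventually_gt_atTop 0)]
    with ⟨b, y⟩ hminor hgap ⟨_, hfy⟩ hb φ hφ hcop
  have logGen_le := hminor φ hφ hcop
  dsimp only at hfy hgap hb logGen_le ⊢
  rw [div_mul_eq_mul_div, div_le_iff₀ (by positivity), ← le_div_iff₀' hfy] at logGen_le
  calc ‖arcIntegrand h k b y φ‖ ≤ Real.exp (-δ * b ^ 2 + 2 * b ^ 2 * f k y) := by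
        rw [norm_arcIntegrand hb.ne', Real.exp_le_exp]
        have := mul_le_mul_of_nonneg_right hgap.le (sq_nonneg b)
        rw [sub_mul, div_mul_eq_mul_div] at this
        linarith
    _ = b ^ 3 * Real.exp (-δ * b ^ 2) * ‖growth k b y‖ := by
        rw [norm_growth hb, Real.exp_add]
        field_simp

lemma norm_integral_sub_integral_symm_le {E : Type*} [NormedAddCommGroup E] [NormedSpace ℝ E]
    {g : ℝ → E} (hg : Continuous g) {η a B : ℝ} (hη : 0 ≤ η) (hηa : η ≤ a)
    (hB : ∀ t, η ≤ |t| → |t| ≤ a → ‖g t‖ ≤ B) :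
    ‖(∫ t in -a..a, g t) - ∫ t in -η..η, g t‖ ≤ B * (2 * (a - η)) := by
  have left_le : ‖∫ t in -a..-η, g t‖ ≤ B * |-η - -a| :=
    intervalIntegral.norm_integral_le_of_norm_le_const fun t ht => by
      rw [Set.uIoc_of_le (neg_le_neg hηa)] at ht
      have := abs_of_nonpos (ht.2.trans (neg_nonpos.2 hη))
      exact hB t (by linarith [ht.2]) (by linarith [ht.1])
  have right_le : ‖∫ t in a..η, g t‖ ≤ B * |η - a| :=
    intervalIntegral.norm_integral_le_of_norm_le_const fun t ht => by
      rw [Set.uIoc_of_ge hηa] at ht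
      have := abs_of_nonneg (hη.trans ht.1.le)
      exact hB t (by linarith [ht.1]) (by linarith [ht.2])
  rw [intervalIntegral.integral_interval_sub_interval_comm (hg.intervalIntegrable _ _)
    (hg.intervalIntegrable _ _) (hg.intervalIntegrable _ _)]
  rw [abs_of_nonneg (by linarith)] at left_le
  rw [abs_of_nonpos (by linarith)] at right_le
  refine (norm_sub_le _ _).trans ?_
  linarith

lemma exists_norm_w_le (h : ℕ) {k : ℕ} (hk : 0 < k) {r : ℝ} (hr0 : 0 ≤ r) (hr : r < 1) :
    ∃ C, ∀ y : ℂ, ‖y‖ ≤ r → ‖w h k y‖ ≤ C := by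
  obtain ⟨C, hC⟩ := exists_forall_pow_eq_one_le hk fun ξ => ‖1 / (ξ - 1)‖
  refine ⟨_, fun y hy => (hasSum_w (hy.trans_lt hr) h hk).norm_le_of_bounded
    ((summable_pow_succ hr0 hr).mul_right (max (1 / 2) C)).hasSum fun m => ?_⟩
  rw [norm_mul, norm_div, norm_pow, norm_natCast_succ]
  gcongr
  · refine (div_le_self (by positivity) (by simp)).trans ?_
    gcongr
  · split_ifs
    · norm_num
    · exact (hC _ (exp_neg_pow_eq_one hk h (m + 1))).trans (le_max_right _ _)

lemma exists_norm_rootCoeff_le (h : ℕ) {k : ℕ} (hk : 0 < k) {r : ℝ} (hr0 : 0 ≤ r) (hr : r < 1) :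
    ∃ C, ∀ (s : ℝ) (y : ℂ), ‖y‖ ≤ r → ‖rootCoeff h k s y‖ ≤ C := by
  obtain ⟨C, hC⟩ := exists_norm_w_le h hk hr0 hr
  refine ⟨Real.exp C, fun s y hy => ?_⟩
  have phase_norm : ‖exp (-2 * π * I * s * h / k)‖ = 1 := by
    rw [← norm_exp_ofReal_mul_I (-2 * π * s * h / k)]
    push_cast
    ring_nf
  rw [rootCoeff]
  split_ifs
  · rw [norm_mul, phase_norm, one_mul]
    exact (norm_exp_le_exp_norm _).trans (Real.exp_le_exp.2 (hC y hy))
  · rw [norm_zero]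
    positivity

lemma tendsto_minor_arc {k : ℕ} {x : ℂ} (hx : x ∈ dominantSet k) (h : ℕ) {M : ℝ} (hM : 0 < M)
    (hML : ‖L k x‖ ^ 2 / M < f k x ^ 2) {η : ℝ × ℂ → ℝ}
    (hη : ∀ᶠ p : ℝ × ℂ in atTop ×ˢ 𝓝 x, 0 ≤ η p ∧ η p ≤ π / k ∧
      (h.Coprime k → M * (f k p.2 / p.1 ^ 2) ≤ η p)) :
    Tendsto (fun p : ℝ × ℂ => (arcIntegral h k p.1 p.2 -
      ∫ φ in -η p..η p, arcIntegrand h k p.1 p.2 φ) / growth k p.1 p.2) (atTop ×ˢ 𝓝 x) (𝓝 0) := by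
  obtain ⟨d, hd, integrand_le⟩ := exists_norm_arcIntegrand_le hx h hM hML
  have bound : Tendsto (fun p : ℝ × ℂ => |d p.1| * (2 * (π / k))) (atTop ×ˢ 𝓝 x) (𝓝 0) := by
    simpa using ((hd.comp tendsto_fst).abs).mul_const (2 * (π / k))
  refine squeeze_zero_norm' ?_ bound
  filter_upwards [integrand_le, hη, tendsto_fst.eventually (eventually_gt_atTop 0),
    eventually_norm_lt_and_f_pos hx.1 (f_pos_of_mem_dominantSet hx) hx.1]
    with p hp ⟨hη0, hηk, hcop⟩ hb ⟨hy, hf⟩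
  have growth_pos : 0 < ‖growth k p.1 p.2‖ := norm_pos_iff.2 (growth_ne_zero hb k p.2)
  rw [norm_div, div_le_iff₀ growth_pos]
  calc _ ≤ d p.1 * ‖growth k p.1 p.2‖ * (2 * (π / k - η p)) :=
        norm_integral_sub_integral_symm_le (continuous_arcIntegrand h hb hy hf) hη0 hηk
          fun φ hφ hφk => hp φ (abs_le.1 hφk) fun hc => (hcop hc).trans hφ
    _ ≤ |d p.1| * ‖growth k p.1 p.2‖ * (2 * (π / k)) := by
        gcongr
        · exact le_abs_self _
        · exact sub_le_self _ hη0
    _ = _ := by ring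

lemma tendsto_arcIntegral_of_not_coprime {k : ℕ} {x : ℂ} (hx : x ∈ dominantSet k) {h : ℕ}
    (hc : ¬h.Coprime k) :
    Tendsto (fun p : ℝ × ℂ => arcIntegral h k p.1 p.2 / growth k p.1 p.2) (atTop ×ˢ 𝓝 x)
      (𝓝 0) := by
  obtain ⟨M, hM, -, hML⟩ := exists_pos_gt_im_and_norm_sq_div_lt (f_pos_of_mem_dominantSet hx)
  refine (tendsto_minor_arc hx h hM hML (η := fun _ => 0)
    (.of_forall fun _ => ⟨le_rfl, by positivity, fun h => absurd h hc⟩)).congr fun p => ?_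
  simp

lemma tendsto_sqrt_pi_mul_csqrt_L {k : ℕ} {x : ℂ} (hx : ‖x‖ < 1) (hf : 0 < f k x) :
    Tendsto (fun p : ℝ × ℂ => √π * csqrt (L k p.2)) (atTop ×ˢ 𝓝 x)
      (𝓝 (√π * csqrt (L k x))) :=
  (((continuousAt_csqrt (.inl hf)).tendsto.comp (continuousAt_L hx hf)).comp
    tendsto_snd).const_mul _

lemma tendsto_arcIntegral_of_coprime {k : ℕ} {x : ℂ} (hx : x ∈ dominantSet k) {h : ℕ}
    (hc : h.Coprime k) :
    Tendsto (fun p : ℝ × ℂ => arcIntegral h k p.1 p.2 / growth k p.1 p.2 -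
      rootCoeff h k (p.1 ^ 4) p.2 * (√π * csqrt (L k p.2))) (atTop ×ˢ 𝓝 x) (𝓝 0) := by
  have hf : 0 < f k x := f_pos_of_mem_dominantSet hx
  have hk : 0 < k := pos_of_mem_dominantSet hx
  obtain ⟨M, hM, hMim, hML⟩ := exists_pos_gt_im_and_norm_sq_div_lt hf
  obtain ⟨r, hxr, hr⟩ := exists_between hx.1
  obtain ⟨C, hC⟩ := exists_norm_rootCoeff_le h hk ((norm_nonneg x).trans hxr.le) hr
  set l : Filter (ℝ × ℂ) := atTop ×ˢ 𝓝 x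
  have near := eventually_norm_lt_and_f_pos hx.1 hf hxr
  have b_pos : ∀ᶠ p : ℝ × ℂ in l, 0 < p.1 := tendsto_fst.eventually (eventually_gt_atTop 0)
  set saddleIntegral : ℝ × ℂ → ℂ := fun p => ∫ t : ℝ, (saddleWindow k M p.1 p.2).indicator
    (fun t => exp (saddleExponent h k p.1 p.2 t)) t
  have tendsto_eta : Tendsto (fun p : ℝ × ℂ => M * f k p.2 / p.1 ^ 2) l (𝓝 0) := by
    simpa only [mul_div_assoc, mul_zero, Function.comp_apply] using ((tendsto_fst.comp
      (tendsto_f_div_sq hx.1 hf)).mono_right nhdsWithin_le_nhds).const_mul M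
  have minor := tendsto_minor_arc hx h hM hML (η := fun p => M * f k p.2 / p.1 ^ 2) <| by
    filter_upwards [near, tendsto_eta.eventually_le_const (show 0 < π / k by positivity)]
      with p ⟨_, hfy⟩ hη
    exact ⟨by positivity, hη, fun _ => (mul_div_assoc _ _ _).ge⟩
  have saddle := (tendsto_integral_saddleWindow hc hx.1 hf hMim).sub
    (tendsto_sqrt_pi_mul_csqrt_L hx.1 hf)
  rw [sub_self] at saddle
  have major : Tendsto (fun p : ℝ × ℂ => rootCoeff h k (p.1 ^ 4) p.2 *
      (saddleIntegral p - √π * csqrt (L k p.2))) l (𝓝 0) :=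
    isBoundedUnder_le_mul_tendsto_zero
      (isBoundedUnder_of_eventually_le (near.mono fun p hp => hC _ _ hp.1.le)) saddle
  have sum_tendsto := minor.add major
  rw [add_zero] at sum_tendsto
  refine sum_tendsto.congr' ?_
  filter_upwards [near, b_pos] with p ⟨_, hfy⟩ hb
  rw [integral_arcIntegrand_saddleWindow hc hb (by positivity), sub_div,
    mul_div_cancel_left₀ _ (growth_ne_zero hb k p.2)]
  ring

theorem tendsto_arcIntegral {k : ℕ} {x : ℂ} (hx : x ∈ dominantSet k) (h : ℕ) :
    Tendsto (fun p : ℝ × ℂ => arcIntegral h k p.1 p.2 / growth k p.1 p.2 -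
      rootCoeff h k (p.1 ^ 4) p.2 * (√π * csqrt (L k p.2))) (atTop ×ˢ 𝓝 x) (𝓝 0) := by
  by_cases hc : h.Coprime k
  · exact tendsto_arcIntegral_of_coprime hx hc
  · simpa [rootCoeff, hc] using tendsto_arcIntegral_of_not_coprime hx hc

/-! ### The asymptotic formula -/

lemma sqrt_sqrt_pow_four {s : ℝ} (hs : 0 ≤ s) : √(√s) ^ 4 = s := by
  rw [show 4 = 2 * 2 from rfl, pow_mul, Real.sq_sqrt (Real.sqrt_nonneg s), Real.sq_sqrt hs]

lemma rpow_neg_three_quarters {s : ℝ} (hs : 0 ≤ s) : s ^ (-(3 / 4) : ℝ) = (√(√s) ^ 3)⁻¹ := by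
  rw [Real.rpow_neg hs, Real.sqrt_eq_rpow, Real.sqrt_eq_rpow, ← Real.rpow_mul hs,
    ← Real.rpow_mul_natCast hs]
  norm_num

lemma mainTerm_eq (k n : ℕ) (y : ℂ) :
    mainTerm k n y = csqrt (L k y) / (2 * √π) * growth k √(√n) y := by
  have sqrt_eq : ((√(√(n : ℝ)) : ℝ) : ℂ) ^ 2 = √(n : ℝ) := by
    exact_mod_cast Real.sq_sqrt (Real.sqrt_nonneg n)
  rw [mainTerm, growth, rpow_neg_three_quarters n.cast_nonneg, sqrt_eq]
  push_cast
  ring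

/-- The coefficient of `mainTerm k n y` in the asymptotic formula for `F n`, which collects the
contributions of the primitive `k`-th roots of unity. -/
def coeffSum (k n : ℕ) (y : ℂ) : ℂ :=
  ∑ h ∈ Finset.range k, rootCoeff h k n y

lemma csqrt_ne_zero {z : ℂ} (hz : z ≠ 0) : csqrt z ≠ 0 := fun h =>
  hz (by rw [← sq_csqrt z, h, zero_pow two_ne_zero])

lemma eval_F_sub_eq {k n : ℕ} (hn : 1 ≤ n) {y : ℂ} (hy : ‖y‖ < 1) (hf : 0 < f k y) :
    (F n).eval y - coeffSum k n y * mainTerm k n y =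
      (∑ h ∈ Finset.range k, (arcIntegral h k √(√n) y / growth k √(√n) y -
        rootCoeff h k (√(√n) ^ 4) y * (√π * csqrt (L k y)))) / (√π * csqrt (L k y)) *
          mainTerm k n y := by
  have hb : 0 < √(√(n : ℝ)) := Real.sqrt_pos.2 (Real.sqrt_pos.2 (by exact_mod_cast hn))
  have hbn : √(√(n : ℝ)) ^ 4 = n := sqrt_sqrt_pow_four n.cast_nonneg
  have growth_ne := growth_ne_zero hb k y
  have csqrt_ne : csqrt (L k y) ≠ 0 := csqrt_ne_zero (ne_zero_of_re_pos hf)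
  have sqrt_pi_ne : (√π : ℂ) ≠ 0 := ofReal_ne_zero.2 (Real.sqrt_pos.2 Real.pi_pos).ne'
  have sq_sqrt_pi : (√π : ℂ) ^ 2 = π := by exact_mod_cast Real.sq_sqrt Real.pi_pos.le
  rw [Finset.sum_sub_distrib, ← Finset.sum_div, ← Finset.sum_mul, sum_arcIntegral hn hb hbn hy hf,
    hbn, ← coeffSum, mainTerm_eq, ← sq_sqrt_pi]
  field_simp

theorem eval_F_sub_isLittleO {k : ℕ} {x : ℂ} (hx : x ∈ dominantSet k) :
    (fun p : ℕ × ℂ => (F p.1).eval p.2 - coeffSum k p.1 p.2 * mainTerm k p.1 p.2)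
      =o[atTop ×ˢ 𝓝 x] fun p => mainTerm k p.1 p.2 := by
  have hf : 0 < f k x := f_pos_of_mem_dominantSet hx
  have tendsto_b : Tendsto (fun p : ℕ × ℂ => (√(√(p.1 : ℝ)), p.2)) (atTop ×ˢ 𝓝 x)
      (atTop ×ˢ 𝓝 x) :=
    (((Real.tendsto_sqrt_atTop.comp Real.tendsto_sqrt_atTop).comp
      tendsto_natCast_atTop_atTop).comp tendsto_fst).prodMk tendsto_snd
  have numerator := tendsto_finsetSum (Finset.range k) fun h _ => tendsto_arcIntegral hx h
  have ratio := (numerator.div (tendsto_sqrt_pi_mul_csqrt_L hx.1 hf) (mul_ne_zero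
    (ofReal_ne_zero.2 (Real.sqrt_pos.2 Real.pi_pos).ne')
    (csqrt_ne_zero (ne_zero_of_re_pos hf)))).comp tendsto_b
  rw [Finset.sum_const_zero, zero_div] at ratio
  refine Asymptotics.isLittleO_iff_exists_eq_mul.2 ⟨_, ratio, ?_⟩
  filter_upwards [tendsto_b.eventually (eventually_norm_lt_and_f_pos hx.1 hf hx.1),
    tendsto_fst.eventually (eventually_ge_atTop 1)] with p ⟨hy, hfy⟩ hn
  exact eval_F_sub_eq hn hy hfy

lemma asympOnCompacts_of_isLittleO {S : Set ℂ} {A B E : ℕ → ℂ → ℂ}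
    (h : ∀ x ∈ S, (fun p : ℕ × ℂ => A p.1 p.2 - B p.1 p.2) =o[atTop ×ˢ 𝓝 x]
      fun p => E p.1 p.2) : AsympOnCompacts S A B E := by
  intro K hK hKS ε hε
  have near_K : ∀ᶠ p : ℕ × ℂ in atTop ×ˢ 𝓝ˢ K, ‖A p.1 p.2 - B p.1 p.2‖ ≤ ε * ‖E p.1 p.2‖ :=
    hK.mem_prod_nhdsSet_of_forall fun x hx => (h x (hKS hx)).bound hε
  exact eventually_atTop.1 <| near_K.curry.mono fun n hn => hn.self_of_nhdsSet

lemma region_subset_dominantSet {k : ℕ} (hk : k ∈ Finset.Icc 1 3) :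
    region k ⊆ dominantSet k := by
  rintro x ⟨hx, hlt⟩
  have f_le : ∀ i ∈ Finset.Icc 1 3, f i x ≤ f k x := fun i hi => by
    rcases eq_or_ne i k with rfl | hik
    · exact le_rfl
    · exact (hlt i hi hik).le
  refine ⟨hx.1, fun j hj hjk => ?_⟩
  rcases le_or_gt j 3 with hj3 | hj3
  · exact hlt j (Finset.mem_Icc.2 ⟨hj, hj3⟩) hjk
  · rcases f_lt_f_one_or_f_two hx hj3 with h | h
    · exact h.trans_le (f_le 1 (by decide))
    · exact h.trans_le (f_le 2 (by decide))

lemma AsympOnCompacts.mono {S T : Set ℂ} {A B E : ℕ → ℂ → ℂ} (h : AsympOnCompacts T A B E)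
    (hST : S ⊆ T) : AsympOnCompacts S A B E := fun K hK hKS => h K hK (hKS.trans hST)

lemma coeffSum_one (n : ℕ) (x : ℂ) : coeffSum 1 n x = exp (w 0 1 x) := by
  simp [coeffSum, rootCoeff]

lemma coeffSum_two (n : ℕ) (x : ℂ) : coeffSum 2 n x = (-1) ^ n * exp (w 1 2 x) := by
  have phase : exp (-2 * π * I * n * (1 : ℕ) / (2 : ℕ)) = (-1) ^ n := by
    rw [← exp_neg_pi_mul_I, ← exp_nat_mul]
    congr 1
    push_cast
    ring
  simp [coeffSum, rootCoeff, Finset.sum_range_succ, ← phase]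

lemma coeffSum_three (n : ℕ) (x : ℂ) : coeffSum 3 n x =
    exp (-2 * π * I * n / 3) * exp (w 1 3 x) + exp (-4 * π * I * n / 3) * exp (w 2 3 x) := by
  rw [coeffSum, Finset.sum_range_succ, Finset.sum_range_succ, Finset.sum_range_one, rootCoeff,
    rootCoeff, rootCoeff, if_neg (by decide), if_pos (by decide), if_pos (by decide), zero_add]
  push_cast
  ring_nf

end PartitionPolynomials

end

theorem mainTheorem2_general (k : ℕ) :
    PartitionPolynomials.AsympOnCompacts (PartitionPolynomials.dominantSet k)
      (fun n x => (PartitionPolynomials.F n).eval x)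
      (fun n x => PartitionPolynomials.coeffSum k n x * PartitionPolynomials.mainTerm k n x)
      (PartitionPolynomials.mainTerm k) :=
  PartitionPolynomials.asympOnCompacts_of_isLittleO fun _ =>
    PartitionPolynomials.eval_F_sub_isLittleO

theorem mainTheorem2 :
    PartitionPolynomials.AsympOnCompacts (PartitionPolynomials.region 1)
      (fun n x => (PartitionPolynomials.F n).eval x)
      (fun n x => Complex.exp (PartitionPolynomials.w 0 1 x) *
        PartitionPolynomials.mainTerm 1 n x)
      (PartitionPolynomials.mainTerm 1) ∧
    PartitionPolynomials.AsympOnCompacts (PartitionPolynomials.region 2)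
      (fun n x => (PartitionPolynomials.F n).eval x)
      (fun n x => (-1) ^ n * Complex.exp (PartitionPolynomials.w 1 2 x) *
        PartitionPolynomials.mainTerm 2 n x)
      (PartitionPolynomials.mainTerm 2) ∧
    PartitionPolynomials.AsympOnCompacts (PartitionPolynomials.region 3)
      (fun n x => (PartitionPolynomials.F n).eval x)
      (fun n x =>
        (Complex.exp (-2 * Real.pi * Complex.I * n / 3) *
            Complex.exp (PartitionPolynomials.w 1 3 x) +
          Complex.exp (-4 * Real.pi * Complex.I * n / 3) *
            Complex.exp (PartitionPolynomials.w 2 3 x)) *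
        PartitionPolynomials.mainTerm 3 n x)
      (PartitionPolynomials.mainTerm 3) := by
  have asymp_region {k : ℕ} (hk : k ∈ Finset.Icc 1 3) :=
    (mainTheorem2_general k).mono (PartitionPolynomials.region_subset_dominantSet hk)
  exact ⟨by simpa only [PartitionPolynomials.coeffSum_one] using asymp_region (k := 1) (by decide),
    by simpa only [PartitionPolynomials.coeffSum_two] using asymp_region (k := 2) (by decide),
    by simpa only [PartitionPolynomials.coeffSum_three] using asymp_region (k := 3) (by decide)⟩
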